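/- **Setting.** Let $A$ be a countable alphabet with a fixed enumeration, $A^{-\mathbb N}$ the set of infinite pasts $\underline z=\ldots z_{-2}z_{-1}$, and $P(a|\underline z)$ a transition probability kernel, i.e. $P(\cdot|\underline z)$ is a probability distribution on $A$ for every $\underline z\in A^{-\mathbb N}$. In conditionings, strings are written from the most recent one backwards: $P(a|b\,w\,c\,\underline z)$ refers to the past that ends with $b$, preceded by $w$, then by $c$, then by $\underline z$. Put $\alpha(a)=\inf_{\underline z}P(a|\underline z)$, $\mathcal E=\{a\in A:\alpha(a)>0\}$, and $\alpha_{-1}=\sum_{a}\alpha(a)$. Assume $\mathcal E\ne\emptyset$ and let $w$ be a finite string of symbols of $\mathcal E$. For a finite string $v$ let $m^w(v)$ be the distance from the end of $v$ to the last occurrence of $w$ in $v$ ($+\infty$ if there is none). For $k\ge 0$ let $$\alpha^w_k=\inf_{i\ge0}\ \inf_{b}\ \inf_{c\in A^k}\ \sum_{a\in A}\inf_{\underline z}P(a|b\,w\,c\,\underline z),$$ where $b$ ranges over the strings of length $i$ such that in the string formed by $w$ followed by $b$ the last occurrence of $w$ is at distance exactly $i$; put $\alpha^w_{-1}=\alpha_{-1}$.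 **Update function.** Glue in $[0,1[$, starting from $0$, first the intervals $I(a)$ of length $\alpha(a)$, in the order of the enumeration of $A$. For a finite string $v$ with $m^w(v)<\infty$ and $0\le k\le|v|-m^w(v)-|w|$, let $\alpha^w(a,v,k)$ be the infimum of $P(a|\cdot)$ over the pasts that agree with $v$ on their last $m^w(v)+|w|+k$ symbols, and $\alpha^w(a,v,-1)=\alpha(a)$; glue successively for $k=0,1,\ldots$, and for each $k$ in the order of the enumeration of $A$, intervals $I^w(a,v,k)$ of length $\alpha^w(a,v,k)-\alpha^w(a,v,k-1)$. For $u\in[0,1[$ and a finite string $v$, let $F(u,v)=a$ if $u<\alpha_{-1}$ and $u\in I(a)$; let $F(u,v)=a$ if $\alpha^w_{l-1}\le u<\alpha^w_l$ for some $l\ge0$, $m^w(v)+|w|+l\le|v|$ and $u\in\bigcup_{k=0}^{l}I^w(a,v,k)$; and let $F(u,v)=\star$ otherwise. **Regeneration time.** Let $(U_i)_{i\in\mathbb Z}$ be i.i.d. uniform on $[0,1[$. For $k\in\mathbb Z$ and $k\le n\le+\infty$, the window $[k,n]$ is constructible if there are symbols $a_i$ with $F(U_i,a_k^{i-1})=a_i$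 for all $k\le i\le n$, $i<\infty$. For $-\infty<m\le n\le+\infty$ let $\theta[m,n]=\max\{k\le m:[k,n]\text{ is constructible}\}$ ($-\infty$ if there is no such $k$), and $\theta[n]=\theta[n,n]$. **Algorithm.** For $-\infty<m\le n<+\infty$: let $B=\{m,\ldots,n\}$, $i\leftarrow m$; while $B\neq\emptyset$ and $F(U_i,X_m^{i-1})\ne\star$, set $X_i\leftarrow F(U_i,X_m^{i-1})$, remove $i$ from $B$, and let $i\leftarrow i+1$. Then let $i\leftarrow m$. While $B\ne\emptyset$: let $i\leftarrow i-1$ and add $i$ to $B$, and repeat these two operations as long as $U_i\in[\alpha_{-1},1[$; set $X_i\leftarrow F(U_i,\emptyset)$, remove $i$ from $B$, let $t\leftarrow\min B$, and, while $B\ne\emptyset$ and $F(U_t,X_i^{t-1})\neq\star$, set $X_t\leftarrow F(U_t,X_i^{t-1})$, remove $t$ from $B$, and let $t\leftarrow\min B$. When $B=\emptyset$, stop and return the time $i$ (with $X_i,\ldots,X_n$). **Theorem 2.** The conditions $\sum_{k\ge0}(1-\alpha^w_k)<\infty$ and $\prod_{k\ge0}\alpha^w_k>0$ are equivalent. If they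 hold (in particular $\alpha^w_k\to1$), then for all $-\infty<m\le n<+\infty$ the algorithm almost surely stops after a finite number of steps, and it returns $\theta[m,n]$, which is finite; for the infinite windows, $\theta[m,+\infty]>-\infty$ almost surely for every $m\in\mathbb Z$. Moreover, for every $n\in\mathbb Z$, $$\sum_{l\ge0}\mathbb P(\theta[n]<n-l)<\infty;\qquad\text{in particular}\qquad \sum_{l\ge0}\mathbb P(\theta[0]<-l)<\infty .$$ -/

import Mathlib

open MeasureTheory ProbabilityTheory
open scoped ENNReal

/-!
Conventions.  The alphabet `A` is countable and enumerated by `Encodable.encode`.  A string of past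
symbols is listed from the most recent symbol backwards: the infinite past `… a₋₂ a₋₁` is the stream
`a₋₁, a₋₂, …`, and the finite past `a₋ₘ … a₋₁` is the list `[a₋₁, …, a₋ₘ]`.  The reference string
`w` is listed in the same way.  A kernel is a map `P : Stream' A → PMF A`, where `P z a` is the
probability of the next symbol `a` given the past `z`, and `v ++ₛ z` is the infinite past which
ends with the finite string `v`.
-/

namespace CFTP

noncomputable section

variable {A : Type*}

/-! ### Occurrences of the reference string -/

/-- `m^w(v)`: the distance to the last occurrence of `w` in the finite past `v`
(`⊤` if there is none). -/
def lastOcc (w v : List A) : ℕ∞ :=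
  ⨅ (k : ℕ) (_ : w <+: v.drop k), (k : ℕ∞)

/-- The strings `b` of length `i` such that, in a past which ends with `w` followed by `b`,
the last occurrence of `w` is at distance exactly `i`. -/
def returnFree (w : List A) (i : ℕ) : Set (List A) :=
  {b | b.length = i ∧ lastOcc w (b ++ w) = i}

/-! ### Infima of the kernel -/

/-- `α(a) = inf_z P(a | z)`. -/
def spontMass (P : Stream' A → PMF A) (a : A) : ℝ≥0∞ :=
  ⨅ z : Stream' A, P z a

/-- The set `ℰ` of symbols `a` with `inf_z P(a | z) > 0`. -/
def minorized (P : Stream' A → PMF A) : Set A :=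
  {a | 0 < spontMass P a}

/-- `α₋₁ = ∑ₐ α(a)`. -/
def alphaNegOne (P : Stream' A → PMF A) : ℝ≥0∞ :=
  ∑' a, spontMass P a

/-- `α^w_k`: the infimum, over all `i`, all `b` of length `i` with no later occurrence of `w`, and
all `c` of length `k`, of `∑ₐ inf_z P(a | b w c z)` (most recent symbols first). -/
def alpha (P : Stream' A → PMF A) (w : List A) (k : ℕ) : ℝ≥0∞ :=
  ⨅ (i : ℕ) (b ∈ returnFree w i) (c : List A) (_ : c.length = k),
    ∑' a, ⨅ z : Stream' A, P ((b ++ w ++ c) ++ₛ z) a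

/-- `α^w_{k-1}` for `k ≥ 0`. -/
def alphaPred (P : Stream' A → PMF A) (w : List A) : ℕ → ℝ≥0∞
  | 0 => alphaNegOne P
  | k + 1 => alpha P w k

/-- `α^w(a, v, k)`: the infimum of `P(a | ·)` over the pasts which agree with `v` up to the `k`
symbols that precede the last occurrence of `w` in `v`.  It is used only when
`m^w(v) + |w| + k ≤ |v|`. -/
def ctxMass (P : Stream' A → PMF A) (w v : List A) (k : ℕ) (a : A) : ℝ≥0∞ :=
  ⨅ z : Stream' A, P (v.take ((lastOcc w v).toNat + w.length + k) ++ₛ z) a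

/-- `α^w(a, v, k-1)` for `k ≥ 0`, with `α(a)` for `k = 0`. -/
def ctxMassPred (P : Stream' A → PMF A) (w v : List A) : ℕ → A → ℝ≥0∞
  | 0 => spontMass P
  | k + 1 => ctxMass P w v k

/-! ### The intervals -/

/-- Intervals of lengths `len a`, glued one after the other in the order of the enumeration of the
alphabet, the first of them starting at `s`: the interval of the symbol `a`. -/
def glued [Encodable A] (s : ℝ≥0∞) (len : A → ℝ≥0∞) (a : A) : Set ℝ≥0∞ :=
  Set.Ico (s + ∑' b : {b : A // Encodable.encode b < Encodable.encode a}, len b)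
    ((s + ∑' b : {b : A // Encodable.encode b < Encodable.encode a}, len b) + len a)

/-- `I(a)`, of length `α(a)`. -/
def spontInterval [Encodable A] (P : Stream' A → PMF A) (a : A) : Set ℝ≥0∞ :=
  glued 0 (spontMass P) a

/-- `I^w(a, v, k)`, of length `α^w(a, v, k) - α^w(a, v, k-1)`; the intervals of index `k` start
where those of index `k-1` end. -/
def ctxInterval [Encodable A] (P : Stream' A → PMF A) (w v : List A) (k : ℕ) (a : A) :
    Set ℝ≥0∞ :=
  glued (∑' b, ctxMassPred P w v k b)
    (fun b => ctxMass P w v k b - ctxMassPred P w v k b) a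

/-! ### The update function -/

/-- Some suffix of the finite past `v` is a context of the tree `τ^w_l`, whose finite contexts are
the strings `c w b` with `b` free of later occurrences of `w` and `|c| = l`. -/
def HasContext (w : List A) (l : ℕ) (v : List A) : Prop :=
  lastOcc w v + w.length + l ≤ v.length

/-- The symbol `a` is selected by `u` and the finite past `v`: either `u < α₋₁` (level `-1`) and
`u ∈ I(a)`, or `α^w_{l-1} ≤ u < α^w_l` for some level `l ≥ 0`, the past `v` contains a context of
`τ^w_l`, and `u ∈ ⋃_{k ≤ l} I^w(a, v, k)`. -/
def Selects [Encodable A] (P : Stream' A → PMF A) (w : List A) (u : ℝ≥0∞) (v : List A) (a : A) :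
    Prop :=
  (u < alphaNegOne P ∧ u ∈ spontInterval P a) ∨
    ∃ l : ℕ, alphaPred P w l ≤ u ∧ u < alpha P w l ∧ HasContext w l v ∧
      ∃ k ≤ l, u ∈ ctxInterval P w v k a

open Classical in
/-- The update function `F(u, v)`; the value `none` is the symbol `⋆`. -/
def update [Encodable A] (P : Stream' A → PMF A) (w : List A) (u : ℝ) (v : List A) : Option A :=
  if h : ∃ a, Selects P w (ENNReal.ofReal u) v a then some h.choose else none

/-! ### The regeneration time -/

/-- The string `a_m … a_{i-1}`, most recent symbol first. -/
def window (a : ℤ → A) (m i : ℤ) : List A :=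
  (List.range (i - m).toNat).map fun j => a (i - 1 - j)

/-- `𝓛(u_m^n) = 1`: the sites of `[m, n]` can all be constructed from `u_m, …, u_n`
(`n = ⊤` is the window `[m, +∞)`). -/
def Constructible [Encodable A] (P : Stream' A → PMF A) (w : List A) (u : ℤ → ℝ)
    (m : ℤ) (n : WithTop ℤ) : Prop :=
  ∃ a : ℤ → A, ∀ i : ℤ, m ≤ i → (i : WithTop ℤ) ≤ n →
    update P w (u i) (window a m i) = some (a i)

open Classical in
/-- `θ[m, n] = max {k ≤ m : 𝓛(u_k^n) = 1}`, which is `⊥` (that is, `-∞`) if there is no such `k`.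
A set of integers which is nonempty and bounded above contains its supremum. -/
def regenTime [Encodable A] (P : Stream' A → PMF A) (w : List A) (u : ℤ → ℝ)
    (m : ℤ) (n : WithTop ℤ) : WithBot ℤ :=
  if {k : ℤ | k ≤ m ∧ Constructible P w u k n}.Nonempty then
    ((sSup {k : ℤ | k ≤ m ∧ Constructible P w u k n} : ℤ) : WithBot ℤ)
  else ⊥

/-! ### The coupling-from-the-past algorithm -/

/-- The instructions of the algorithm. -/
inductive Instr
  | fwdTest | fwdAssign | fwdRemove | fwdNext | restart
  | outerTest | backMove | backAdd
  | skipTest | skipMove | skipAdd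
  | seedAssign | seedRemove | seedMin
  | extTest | extAssign | extRemove | extMin
  | setTime | halt
  deriving DecidableEq

/-- A configuration: the next instruction, the variables `i`, `t`, `θ`, the set `B` of the sites
which remain to be constructed, and the sites constructed so far (`none` is `⋆`). -/
structure Config (A : Type*) where
  pc : Instr
  i : ℤ
  t : ℤ
  theta : ℤ
  B : Finset ℤ
  X : ℤ → Option A

/-- The string `X_m … X_{i-1}` in the memory of the algorithm, most recent symbol first.  Whenever
the algorithm reads it, all these sites have been constructed. -/
def memWindow (X : ℤ → Option A) (m i : ℤ) : List A :=
  (List.range (i - m).toNat).filterMap fun j => X (i - 1 - j)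

/-- The initial configuration for the window `[m, n]`. -/
def Config.init (A : Type*) (m n : ℤ) : Config A where
  pc := .fwdTest
  i := m
  t := m
  theta := m
  B := Finset.Icc m n
  X := fun _ => none

open Classical in
/-- One step of the algorithm, run on the uniform variables `u` (to sample `U_i` is to read `u i`).
The assignment of the minimum of `B` to `t` is void if `B` is empty.

* Forward phase: while `B ≠ ∅` and `F(u_i, X_m^{i-1}) ≠ ⋆`, construct the site `i`, remove it from
  `B`, and pass to `i + 1`.  Then `i ← m`.
* While `B ≠ ∅`: move `i` one step back and add it to `B`, and again as long as `u_i ∈ [α₋₁, 1)`;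
  set `X_i ← F(u_i, ∅)`, remove `i` from `B`, let `t ← min B`, and, while `B ≠ ∅` and
  `F(u_t, X_i^{t-1}) ≠ ⋆`, construct the site `t`, remove it from `B`, and let `t ← min B`.
* Let `θ ← i` and halt. -/
def step [Encodable A] (P : Stream' A → PMF A) (w : List A) (u : ℤ → ℝ) (m : ℤ)
    (s : Config A) : Config A :=
  match s.pc with
  | .fwdTest =>
      if s.B.Nonempty ∧ (update P w (u s.i) (memWindow s.X m s.i)).isSome then
        { s with pc := .fwdAssign }
      else { s with pc := .restart }
  | .fwdAssign =>
      { s with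
        pc := .fwdRemove
        X := Function.update s.X s.i (update P w (u s.i) (memWindow s.X m s.i)) }
  | .fwdRemove => { s with pc := .fwdNext, B := s.B.erase s.i }
  | .fwdNext => { s with pc := .fwdTest, i := s.i + 1 }
  | .restart => { s with pc := .outerTest, i := m }
  | .outerTest =>
      if s.B.Nonempty then { s with pc := .backMove } else { s with pc := .setTime }
  | .backMove => { s with pc := .backAdd, i := s.i - 1 }
  | .backAdd => { s with pc := .skipTest, B := insert s.i s.B }
  | .skipTest =>
      if alphaNegOne P ≤ ENNReal.ofReal (u s.i) then { s with pc := .skipMove }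
      else { s with pc := .seedAssign }
  | .skipMove => { s with pc := .skipAdd, i := s.i - 1 }
  | .skipAdd => { s with pc := .skipTest, B := insert s.i s.B }
  | .seedAssign =>
      { s with pc := .seedRemove, X := Function.update s.X s.i (update P w (u s.i) []) }
  | .seedRemove => { s with pc := .seedMin, B := s.B.erase s.i }
  | .seedMin => { s with pc := .extTest, t := s.B.min.untopD s.t }
  | .extTest =>
      if s.B.Nonempty ∧ (update P w (u s.t) (memWindow s.X s.i s.t)).isSome then
        { s with pc := .extAssign }
      else { s with pc := .outerTest }
  | .extAssign =>
      { s with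
        pc := .extRemove
        X := Function.update s.X s.t (update P w (u s.t) (memWindow s.X s.i s.t)) }
  | .extRemove => { s with pc := .extMin, B := s.B.erase s.t }
  | .extMin => { s with pc := .extTest, t := s.B.min.untopD s.t }
  | .setTime => { s with pc := .halt, theta := s.i }
  | .halt => s

/-- Run on the window `[m, n]` with the uniform variables `u`, the algorithm stops after a finite
number of steps, and the time which it returns is `r`. -/
def StopsWith [Encodable A] (P : Stream' A → PMF A) (w : List A) (u : ℤ → ℝ) (m n : ℤ)
    (r : ℤ) : Prop :=
  ∃ N : ℕ, ((step P w u m)^[N] (Config.init A m n)).pc = .halt ∧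
    ((step P w u m)^[N] (Config.init A m n)).theta = r

end

end CFTP

/-!
The update function reads the past only through its context at the last occurrence of `w`, so a
symbol which it has produced from a finite past is not altered when that past is extended.  Hence
the symbols which the algorithm has stored stay correct as it moves back, and it stops exactly at
the last time from which the whole window can be constructed.

A site is passed as soon as its variable is below `α₋₁`, or below the level given by the distance
from the start to some occurrence of `w` which was produced without looking at the past.  All the
sites of `[0, ∞)` satisfy this with positive probability `c`: force an initial stretch to spell
copies of `e w` with `e ∈ ℰ` (so that the blocks are not empty when `w` is), and note that later on,
by independence and summability, it is likely that `w` recurs in every range of blocks `[K, 2K)`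
and that the variable at the site `k` is below a level proportional to `k`.

Finally, the events "no start in `[0, l]` succeeds up to `l`, but the start at `l + 1` succeeds
forever" are disjoint, and by independence the probability of each is `c` times that of its first
half.  The probabilities of the first halves thus sum to at most `1 / c`, which bounds the tail of
the regeneration time and, by Borel–Cantelli, yields a start which succeeds forever.
-/

namespace CFTP

/-! ### Series and infinite products -/

section Series

lemma sum_prod_mul_one_sub_add_prod {b : ℕ → ℝ≥0∞} (hb : ∀ k, b k ≤ 1) (N : ℕ) :
    ∑ k ∈ Finset.range N, (∏ j ∈ Finset.range k, b j) * (1 - b k) +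
      ∏ k ∈ Finset.range N, b k = 1 := by
  induction N with
  | zero => simp
  | succ N ih =>
    rw [Finset.sum_range_succ, Finset.prod_range_succ, add_assoc, ← mul_add,
      tsub_add_cancel_of_le (hb N), mul_one, ih]

lemma one_sub_sum_le_prod {b : ℕ → ℝ≥0∞} (hb : ∀ k, b k ≤ 1) (N : ℕ) :
    1 - ∑ k ∈ Finset.range N, (1 - b k) ≤ ∏ k ∈ Finset.range N, b k := by
  refine tsub_le_iff_left.2 ((sum_prod_mul_one_sub_add_prod hb N).ge.trans ?_)
  gcongr with k
  exact mul_le_of_le_one_left' (Finset.prod_le_one' fun j _ => hb j)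

lemma iInf_prod_pos_of_tsum_one_sub_lt_top {b : ℕ → ℝ≥0∞} (hb : ∀ k, b k ≤ 1)
    (hpos : ∀ k, 0 < b k) (h : ∑' k, (1 - b k) < ∞) :
    0 < ⨅ N : ℕ, ∏ k ∈ Finset.range N, b k := by
  obtain ⟨M, hM⟩ : ∃ M, ∑' k, (1 - b (k + M)) < 1 :=
    ((ENNReal.tendsto_sum_nat_add _ h.ne).eventually_lt_const one_pos).exists
  have hprod : ∏ k ∈ Finset.range M, b k ≠ 0 :=
    Finset.prod_ne_zero_iff.2 fun k _ => (hpos k).ne'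
  refine (ENNReal.mul_pos hprod (tsub_pos_of_lt hM).ne').trans_le (le_iInf fun N => ?_)
  calc (∏ k ∈ Finset.range M, b k) * (1 - ∑' k, (1 - b (k + M)))
      ≤ (∏ k ∈ Finset.range M, b k) * ∏ k ∈ Finset.range N, b (M + k) := by
        gcongr
        refine le_trans (tsub_le_tsub_left ?_ 1) (one_sub_sum_le_prod (fun k => hb (M + k)) N)
        simpa only [add_comm M] using ENNReal.sum_le_tsum (Finset.range N)
    _ = ∏ k ∈ Finset.range (M + N), b k := (Finset.prod_range_add _ _ _).symm
    _ ≤ ∏ k ∈ Finset.range N, b k := by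
        rw [add_comm, Finset.prod_range_add]
        exact mul_le_of_le_one_right' (Finset.prod_le_one' fun k _ => hb _)

lemma tsum_one_sub_lt_top_of_iInf_prod_pos {b : ℕ → ℝ≥0∞} (hb : ∀ k, b k ≤ 1)
    (h : 0 < ⨅ N : ℕ, ∏ k ∈ Finset.range N, b k) : ∑' k, (1 - b k) < ∞ := by
  have hmul : (⨅ N : ℕ, ∏ k ∈ Finset.range N, b k) * ∑' k, (1 - b k) ≤ 1 := by
    rw [← ENNReal.tsum_mul_left]
    refine ENNReal.tsum_le_of_sum_range_le fun N => ?_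
    refine le_trans ?_ (le_self_add.trans_eq (sum_prod_mul_one_sub_add_prod hb N))
    gcongr with k
    exact iInf_le _ k
  exact ENNReal.lt_top_of_mul_ne_top_right (hmul.trans_lt ENNReal.one_lt_top).ne h.ne'

lemma tsum_one_sub_lt_top_iff {b : ℕ → ℝ≥0∞} (hb : ∀ k, b k ≤ 1) (hpos : ∀ k, 0 < b k) :
    ∑' k, (1 - b k) < ∞ ↔ 0 < ⨅ N : ℕ, ∏ k ∈ Finset.range N, b k :=
  ⟨iInf_prod_pos_of_tsum_one_sub_lt_top hb hpos, tsum_one_sub_lt_top_of_iInf_prod_pos hb⟩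

lemma tsum_div_eq_mul_tsum (f : ℕ → ℝ≥0∞) (d : ℕ) [NeZero d] :
    ∑' k, f (k / d) = d * ∑' k, f k := by
  calc ∑' k, f (k / d) = ∑' p : ℕ × Fin d, f p.1 :=
        (Nat.divModEquiv d).tsum_eq fun p : ℕ × Fin d => f p.1
    _ = d * ∑' k, f k := by
        rw [ENNReal.tsum_prod (f := fun k (_ : Fin d) => f k), ← ENNReal.tsum_mul_left]
        simp

lemma exists_le_and_lt_succ {α : Type*} [LinearOrder α] {g : ℕ → α} {x : α} {l : ℕ}
    (h0 : g 0 ≤ x) (hl : x < g (l + 1)) : ∃ k ≤ l, g k ≤ x ∧ x < g (k + 1) := by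
  induction l with
  | zero => exact ⟨0, le_rfl, h0, hl⟩
  | succ l ih =>
    rcases lt_or_ge x (g (l + 1)) with h | h
    · obtain ⟨k, hk, hkx⟩ := ih h
      exact ⟨k, hk.trans l.le_succ, hkx⟩
    · exact ⟨l + 1, le_rfl, h, hl⟩

end Series

/-! ### Gluing intervals -/

section Gluing

variable {A : Type*} [Encodable A] {s u : ℝ≥0∞} {len : A → ℝ≥0∞} {a b : A} {N : ℕ}

open Encodable

/-- The total length of the intervals of the symbols whose code is below `N`, hence the position
at which the interval of the symbol with code `N` starts. -/
noncomputable def cumLength (len : A → ℝ≥0∞) (N : ℕ) : ℝ≥0∞ :=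
  ∑' b : {b : A // encode b < N}, len b

lemma cumLength_eq_tsum_ite (len : A → ℝ≥0∞) (N : ℕ) :
    cumLength len N = ∑' b, if encode b < N then len b else 0 :=
  (tsum_subtype {b : A | encode b < N} len).trans
    (tsum_congr fun b => by simp only [Set.indicator_apply, Set.mem_ofPred_eq])

lemma cumLength_zero (len : A → ℝ≥0∞) : cumLength len 0 = 0 := by
  simp [cumLength_eq_tsum_ite]

lemma cumLength_mono (len : A → ℝ≥0∞) : Monotone (cumLength len) := fun _ _ h =>
  ENNReal.tsum_mono_subtype len fun _ hb => lt_of_lt_of_le hb h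

lemma cumLength_encode_succ (len : A → ℝ≥0∞) (a : A) :
    cumLength len (encode a + 1) = cumLength len (encode a) + len a := by
  classical
  rw [cumLength_eq_tsum_ite, cumLength_eq_tsum_ite, ← tsum_ite_eq a len, ← ENNReal.tsum_add]
  refine tsum_congr fun b => ?_
  rcases eq_or_ne b a with rfl | hb
  · simp
  · have := encode_injective.ne hb
    simp only [Nat.lt_succ_iff_lt_or_eq, this, or_false, hb, if_false, add_zero]

lemma cumLength_succ_of_forall_encode_ne (len : A → ℝ≥0∞) (h : ∀ a : A, encode a ≠ N) :
    cumLength len (N + 1) = cumLength len N := by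
  simp only [cumLength_eq_tsum_ite, Nat.lt_succ_iff_lt_or_eq, h, or_false]

lemma iSup_cumLength (len : A → ℝ≥0∞) : ⨆ N, cumLength len N = ∑' b, len b := by
  refine le_antisymm (iSup_le fun N => ENNReal.tsum_comp_le_tsum_of_injective
    Subtype.val_injective len) ?_
  rw [ENNReal.tsum_eq_iSup_sum]
  refine iSup_le fun t => le_iSup_of_le (t.sup encode + 1) ?_
  rw [cumLength_eq_tsum_ite]
  refine le_of_eq_of_le (Finset.sum_congr rfl fun b hb => ?_) (ENNReal.sum_le_tsum t)
  rw [if_pos (Nat.lt_succ_of_le (Finset.le_sup hb))]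

lemma mem_glued : u ∈ glued s len a ↔
    s + cumLength len (encode a) ≤ u ∧ u < s + cumLength len (encode a + 1) := by
  rw [cumLength_encode_succ, ← add_assoc]
  rfl

lemma exists_mem_glued (h1 : s ≤ u) (h2 : u < s + ∑' b, len b) : ∃ a, u ∈ glued s len a := by
  obtain ⟨N, hN⟩ : ∃ N, u < s + cumLength len N := by
    rwa [← iSup_cumLength, ENNReal.add_iSup, lt_iSup_iff] at h2
  obtain ⟨M, -, hlow, hup⟩ := exists_le_and_lt_succ (g := fun N => s + cumLength len N) (x := u)
    (by simpa only [cumLength_zero, add_zero])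
    (hN.trans_le (add_le_add_right (cumLength_mono len N.le_succ) s))
  obtain ⟨a, rfl⟩ : ∃ a : A, encode a = M := by
    by_contra! hcode
    rw [cumLength_succ_of_forall_encode_ne len hcode] at hup
    exact hup.not_ge hlow
  exact ⟨a, mem_glued.2 ⟨hlow, hup⟩⟩

lemma glued_unique (ha : u ∈ glued s len a) (hb : u ∈ glued s len b) : a = b := by
  have encode_le {c d : A} (hc : u ∈ glued s len c) (hd : u ∈ glued s len d) :
      encode c ≤ encode d := by
    by_contra! hlt
    exact ((mem_glued.1 hc).1.trans_lt (mem_glued.1 hd).2).not_ge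
      (add_le_add_right (cumLength_mono len hlt) s)
  exact encode_injective (le_antisymm (encode_le ha hb) (encode_le hb ha))

lemma glued_subset_Ico : glued s len a ⊆ Set.Ico s (s + ∑' b, len b) := by
  intro u hu
  rw [mem_glued] at hu
  refine ⟨le_self_add.trans hu.1, hu.2.trans_le (add_le_add_right ?_ s)⟩
  exact (le_iSup _ _).trans_eq (iSup_cumLength len)

end Gluing

/-! ### Infima of the kernel -/

section Infima

variable {A : Type*} (P : Stream' A → PMF A)

lemma iInf_append_le (v v' : List A) (a : A) :
    ⨅ z : Stream' A, P (v ++ₛ z) a ≤ ⨅ z : Stream' A, P ((v ++ v') ++ₛ z) a := by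
  refine le_iInf fun z => ?_
  rw [Stream'.append_append_stream]
  exact iInf_le _ _

lemma spontMass_le (v : List A) (a : A) : spontMass P a ≤ ⨅ z : Stream' A, P (v ++ₛ z) a :=
  le_iInf fun _ => iInf_le _ _

lemma tsum_iInf_le_one [Nonempty A] (v : List A) :
    ∑' a, ⨅ z : Stream' A, P (v ++ₛ z) a ≤ 1 := by
  obtain ⟨z⟩ : Nonempty (Stream' A) := inferInstanceAs (Nonempty (ℕ → A))
  rw [← (P (v ++ₛ z)).tsum_coe]
  exact ENNReal.tsum_le_tsum fun a => iInf_le _ z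

lemma alphaNegOne_pos (hE : (minorized P).Nonempty) : 0 < alphaNegOne P :=
  hE.some_mem.trans_le (ENNReal.le_tsum _)

lemma alphaNegOne_le_alpha (w : List A) (k : ℕ) : alphaNegOne P ≤ alpha P w k :=
  le_iInf fun _ => le_iInf₂ fun _ _ => le_iInf₂ fun _ _ =>
    ENNReal.tsum_le_tsum fun a => spontMass_le P _ a

variable {P} in
lemma alpha_le_of_mem_returnFree {w b c : List A} {i k : ℕ} (hb : b ∈ returnFree w i)
    (hc : c.length = k) : alpha P w k ≤ ∑' a, ⨅ z : Stream' A, P ((b ++ w ++ c) ++ₛ z) a :=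
  (iInf_le _ i).trans ((iInf₂_le b hb).trans (iInf₂_le c hc))

lemma lastOcc_self (w : List A) : lastOcc w w = 0 :=
  le_antisymm (iInf₂_le 0 (List.prefix_refl w)) zero_le

lemma nil_mem_returnFree (w : List A) : [] ∈ returnFree w 0 :=
  ⟨rfl, lastOcc_self w⟩

lemma alpha_le_one [Nonempty A] (w : List A) (k : ℕ) : alpha P w k ≤ 1 :=
  (alpha_le_of_mem_returnFree (nil_mem_returnFree w)
    (List.length_replicate (a := Classical.arbitrary A))).trans (tsum_iInf_le_one P _)

lemma alpha_mono (w : List A) : Monotone (alpha P w) := by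
  refine monotone_nat_of_le_succ fun k => ?_
  refine le_iInf fun i => le_iInf₂ fun b hb => le_iInf₂ fun c hc => ?_
  have hk : (c.take k).length = k := by simp [hc]
  refine (alpha_le_of_mem_returnFree hb hk).trans (ENNReal.tsum_le_tsum fun a => ?_)
  have := iInf_append_le P (b ++ w ++ c.take k) (c.drop k) a
  rwa [List.append_assoc _ (c.take k), List.take_append_drop] at this

lemma alphaNegOne_le_alphaPred (w : List A) : ∀ k, alphaNegOne P ≤ alphaPred P w k
  | 0 => le_rfl
  | k + 1 => alphaNegOne_le_alpha P w k

lemma ctxMass_mono (w v : List A) (a : A) : Monotone fun k => ctxMass P w v k a := by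
  refine monotone_nat_of_le_succ fun k => ?_
  have := iInf_append_le P (v.take ((lastOcc w v).toNat + w.length + k))
    ((v.drop ((lastOcc w v).toNat + w.length + k)).take 1) a
  rwa [← List.take_add] at this

lemma ctxMassPred_le (w v : List A) (a : A) : ∀ k, ctxMassPred P w v k a ≤ ctxMass P w v k a
  | 0 => spontMass_le P _ a
  | k + 1 => ctxMass_mono P w v a k.le_succ

lemma tsum_ctxMassPred_add_tsum_sub (w v : List A) (k : ℕ) :
    ∑' b, ctxMassPred P w v k b + ∑' b, (ctxMass P w v k b - ctxMassPred P w v k b) =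
      ∑' b, ctxMass P w v k b := by
  rw [← ENNReal.tsum_add]
  exact tsum_congr fun b => add_tsub_cancel_of_le (ctxMassPred_le P w v b k)

end Infima

/-! ### Occurrences of the reference string -/

section Occurrences

variable {A : Type*} {w v : List A} {m k l : ℕ}

lemma natCast_le_lastOcc_iff : (m : ℕ∞) ≤ lastOcc w v ↔ ∀ k, w <+: v.drop k → m ≤ k := by
  simp only [lastOcc, le_iInf_iff, Nat.cast_le]

lemma lastOcc_eq_natCast_iff :
    lastOcc w v = m ↔ w <+: v.drop m ∧ ∀ k < m, ¬ w <+: v.drop k := by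
  refine ⟨fun h => ?_, fun ⟨hm, hlt⟩ => le_antisymm (iInf₂_le m hm) ?_⟩
  · have hlt : ∀ k < m, ¬ w <+: v.drop k := fun k hk hw =>
      hk.not_ge (natCast_le_lastOcc_iff.1 h.ge k hw)
    refine ⟨?_, hlt⟩
    by_contra hm
    have hsucc : ((m + 1 : ℕ) : ℕ∞) ≤ lastOcc w v := natCast_le_lastOcc_iff.2 fun k hk => by
      by_contra! hkm
      rcases Nat.lt_succ_iff_lt_or_eq.1 hkm with hkm | rfl
      exacts [hlt k hkm hk, hm hk]
    rw [h, Nat.cast_le] at hsucc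
    exact m.lt_succ_self.not_ge hsucc
  · exact natCast_le_lastOcc_iff.2 fun k hk => not_lt.1 fun hkm => hlt k hkm hk

lemma prefix_drop_append_iff (hk : k + w.length ≤ v.length) (v' : List A) :
    w <+: (v ++ v').drop k ↔ w <+: v.drop k := by
  rw [List.drop_append_of_le_length (by omega)]
  refine ⟨fun h => ?_, fun h => h.trans (List.prefix_append _ _)⟩
  exact List.prefix_of_prefix_length_le h (List.prefix_append _ _) (by rw [List.length_drop]; omega)

lemma lastOcc_append_eq_natCast_iff (hm : m + w.length ≤ v.length) (v' : List A) :
    lastOcc w (v ++ v') = m ↔ lastOcc w v = m := by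
  rw [lastOcc_eq_natCast_iff, lastOcc_eq_natCast_iff, prefix_drop_append_iff hm]
  refine and_congr_right fun _ => forall₂_congr fun k hk => not_congr ?_
  exact prefix_drop_append_iff (by omega) v'

lemma hasContext_iff : HasContext w l v ↔
    ∃ m : ℕ, lastOcc w v = m ∧ m + w.length + l ≤ v.length := by
  unfold HasContext
  cases h : lastOcc w v with
  | top => simp
  | coe m =>
    simp only [Nat.cast_inj, exists_eq_left']
    norm_cast

lemma hasContext_of_prefix_drop (h : w <+: v.drop m) (hl : m + w.length + l ≤ v.length) :
    HasContext w l v := by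
  calc lastOcc w v + w.length + l ≤ (m : ℕ∞) + w.length + l := by gcongr; exact iInf₂_le m h
    _ ≤ v.length := by exact_mod_cast hl

lemma HasContext.mono (hkl : k ≤ l) (h : HasContext w l v) : HasContext w k v :=
  le_trans (by gcongr) h

lemma HasContext.lastOcc_append (h : HasContext w l v) (v' : List A) :
    lastOcc w (v ++ v') = lastOcc w v := by
  obtain ⟨m, hm, hlen⟩ := hasContext_iff.1 h
  rw [hm, lastOcc_append_eq_natCast_iff (by omega), hm]

lemma HasContext.append (h : HasContext w l v) (v' : List A) : HasContext w l (v ++ v') := by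
  unfold HasContext
  rw [h.lastOcc_append]
  exact h.trans (by simp)

variable (P : Stream' A → PMF A)

lemma HasContext.alpha_le (h : HasContext w l v) : alpha P w l ≤ ∑' a, ctxMass P w v l a := by
  obtain ⟨m, hm, hlen⟩ := hasContext_iff.1 h
  have hw : w = (v.drop m).take w.length :=
    List.prefix_iff_eq_take.1 (lastOcc_eq_natCast_iff.1 hm).1
  have hbw : v.take m ++ w = v.take (m + w.length) := by rw [List.take_add, ← hw]
  have hb : v.take m ∈ returnFree w m := by
    refine ⟨by rw [List.length_take]; omega, ?_⟩
    rw [hbw, ← lastOcc_append_eq_natCast_iff (by rw [List.length_take]; omega)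
      (v.drop (m + w.length)), List.take_append_drop, hm]
  have hc : ((v.drop (m + w.length)).take l).length = l := by
    rw [List.length_take, List.length_drop]; omega
  have hα := alpha_le_of_mem_returnFree (P := P) hb hc
  rw [hbw, ← List.take_add] at hα
  simpa only [ctxMass, hm, ENat.toNat_natCast] using hα

lemma HasContext.ctxMass_append (h : HasContext w l v) (v' : List A) (hk : k ≤ l) :
    ctxMass P w (v ++ v') k = ctxMass P w v k := by
  obtain ⟨m, hm, hlen⟩ := hasContext_iff.1 h
  unfold ctxMass
  rw [h.lastOcc_append, hm, ENat.toNat_natCast, List.take_append_of_le_length (by omega)]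

lemma HasContext.ctxMassPred_append (h : HasContext w l v) (v' : List A) (hk : k ≤ l) :
    ctxMassPred P w (v ++ v') k = ctxMassPred P w v k := by
  cases k with
  | zero => rfl
  | succ k => exact h.ctxMass_append P v' (k.le_succ.trans hk)

lemma HasContext.ctxInterval_append [Encodable A] (h : HasContext w l v) (v' : List A)
    (hk : k ≤ l) : ctxInterval P w (v ++ v') k = ctxInterval P w v k := by
  unfold ctxInterval
  rw [h.ctxMass_append P v' hk, h.ctxMassPred_append P v' hk]

end Occurrences

/-! ### The update function -/

section Update

variable {A : Type*} [Encodable A] {P : Stream' A → PMF A} {w v : List A} {k l : ℕ} {a b : A}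

lemma lt_alphaNegOne_of_mem_spontInterval {u : ℝ≥0∞} (h : u ∈ spontInterval P a) :
    u < alphaNegOne P :=
  (glued_subset_Ico h).2.trans_eq (zero_add _)

lemma ctxInterval_subset_Ico : ctxInterval P w v k a ⊆
    Set.Ico (∑' b, ctxMassPred P w v k b) (∑' b, ctxMass P w v k b) := by
  rw [← tsum_ctxMassPred_add_tsum_sub]
  exact glued_subset_Ico

lemma ctxInterval_unique {u : ℝ≥0∞} (ha : u ∈ ctxInterval P w v k a)
    (hb : u ∈ ctxInterval P w v l b) : a = b := by
  have le_of_mem {k l : ℕ} {a b : A} (ha : u ∈ ctxInterval P w v k a)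
      (hb : u ∈ ctxInterval P w v l b) : k ≤ l := by
    by_contra! hlt
    obtain ⟨j, rfl⟩ := Nat.exists_eq_add_one_of_ne_zero hlt.ne_bot
    have hlj : ∑' b, ctxMass P w v l b ≤ ∑' b, ctxMass P w v j b :=
      ENNReal.tsum_le_tsum fun b => ctxMass_mono P w v b (Nat.lt_succ_iff.1 hlt)
    exact ((ctxInterval_subset_Ico ha).1.trans_lt (ctxInterval_subset_Ico hb).2).not_ge hlj
  obtain rfl := le_antisymm (le_of_mem ha hb) (le_of_mem hb ha)
  exact glued_unique ha hb

lemma Selects.unique {u : ℝ≥0∞} (ha : Selects P w u v a) (hb : Selects P w u v b) : a = b := by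
  rcases ha with ⟨h, ha⟩ | ⟨l, hl, -, -, k, -, ha⟩ <;>
    rcases hb with ⟨h', hb⟩ | ⟨l', hl', -, -, k', -, hb⟩
  · exact glued_unique ha hb
  · exact absurd h ((alphaNegOne_le_alphaPred P w l').trans hl').not_gt
  · exact absurd h' ((alphaNegOne_le_alphaPred P w l).trans hl).not_gt
  · exact ctxInterval_unique ha hb

variable {u : ℝ}

lemma update_eq_some_iff : update P w u v = some a ↔ Selects P w (ENNReal.ofReal u) v a := by
  unfold update
  split_ifs with h
  · rw [Option.some.injEq]
    exact ⟨fun e => e ▸ h.choose_spec, fun ha => h.choose_spec.unique ha⟩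
  · exact iff_of_false nofun fun ha => h ⟨a, ha⟩

lemma update_append (h : update P w u v = some a) (v' : List A) :
    update P w u (v ++ v') = some a := by
  rw [update_eq_some_iff] at h ⊢
  rcases h with h | ⟨l, hlow, hup, hc, k, hk, hu⟩
  · exact Or.inl h
  · refine Or.inr ⟨l, hlow, hup, hc.append v', k, hk, ?_⟩
    rwa [hc.ctxInterval_append P v' hk]

lemma update_of_mem_spontInterval (h : ENNReal.ofReal u ∈ spontInterval P a) (v : List A) :
    update P w u v = some a :=
  update_eq_some_iff.2 (Or.inl ⟨lt_alphaNegOne_of_mem_spontInterval h, h⟩)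

lemma exists_update_of_lt_alphaNegOne (h : ENNReal.ofReal u < alphaNegOne P) (w v : List A) :
    ∃ a, update P w u v = some a := by
  obtain ⟨a, ha⟩ := exists_mem_glued (A := A) (len := spontMass P) zero_le
    (h.trans_eq (zero_add _).symm)
  exact ⟨a, update_of_mem_spontInterval ha v⟩

lemma exists_mem_ctxInterval {u : ℝ≥0∞} (h0 : alphaNegOne P ≤ u)
    (hl : u < ∑' b, ctxMass P w v l b) : ∃ k ≤ l, ∃ a, u ∈ ctxInterval P w v k a := by
  obtain ⟨k, hkl, hlow, hup⟩ :=
    exists_le_and_lt_succ (g := fun k => ∑' b, ctxMassPred P w v k b) h0 hl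
  exact ⟨k, hkl, exists_mem_glued hlow (hup.trans_eq (tsum_ctxMassPred_add_tsum_sub ..).symm)⟩

lemma exists_update_of_hasContext (hc : HasContext w l v) (h : ENNReal.ofReal u < alpha P w l) :
    ∃ a, update P w u v = some a := by
  rcases lt_or_ge (ENNReal.ofReal u) (alphaNegOne P) with h0 | h0
  · exact exists_update_of_lt_alphaNegOne h0 w v
  obtain ⟨j, hjl, hlow, hup⟩ := exists_le_and_lt_succ (g := alphaPred P w) h0 h
  have hcj : HasContext w j v := hc.mono hjl
  obtain ⟨k, hkj, a, ha⟩ := exists_mem_ctxInterval h0 (hup.trans_le (hcj.alpha_le P))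
  exact ⟨a, update_eq_some_iff.2 (Or.inr ⟨j, hlow, hup, hcj, k, hkj, ha⟩)⟩

lemma lt_alphaNegOne_of_update_nil (h : update P w u [] = some a) :
    ENNReal.ofReal u < alphaNegOne P := by
  rcases update_eq_some_iff.1 h with h | ⟨l, -, hup, hc, -⟩
  · exact h.1
  · refine hup.trans_le ((hc.alpha_le P).trans_eq (tsum_congr fun a => ?_))
    simp [ctxMass, spontMass]

end Update

/-! ### Windows -/

section Windows

variable {A : Type*} {a : ℤ → A} {X Y : ℤ → Option A} {m r i : ℤ}

lemma window_eq_map (a : ℤ → A) (m i : ℤ) :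
    window a m i = (List.range (i - m).toNat).map fun j : ℕ => a (i - 1 - j) := by
  simp only [window, bind, pure, ← List.map_eq_flatMap, List.map_map, Function.comp_def]

lemma memWindow_eq_filterMap (X : ℤ → Option A) (m i : ℤ) :
    memWindow X m i = (List.range (i - m).toNat).filterMap fun j : ℕ => X (i - 1 - j) := by
  simp only [memWindow, bind, pure, ← List.map_eq_flatMap, List.filterMap_map, Function.comp_def]

lemma window_self (a : ℤ → A) (m : ℤ) : window a m m = [] := by
  simp [window]

lemma memWindow_self (X : ℤ → Option A) (m : ℤ) : memWindow X m m = [] := by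
  simp [memWindow]

lemma memWindow_append_memWindow (X : ℤ → Option A) (hmr : m ≤ r) (hri : r ≤ i) :
    memWindow X r i ++ memWindow X m r = memWindow X m i := by
  have hlen : (i - m).toNat = (i - r).toNat + (r - m).toNat := by omega
  simp only [memWindow_eq_filterMap]
  rw [hlen, List.range_add, List.filterMap_append, List.filterMap_map]
  refine congrArg _ (List.filterMap_congr fun j _ => congrArg X ?_)
  push_cast
  omega

lemma memWindow_congr (h : ∀ l, m ≤ l → l < i → X l = Y l) :
    memWindow X m i = memWindow Y m i := by
  simp only [memWindow_eq_filterMap]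
  refine List.filterMap_congr fun j hj => ?_
  rw [List.mem_range] at hj
  exact h _ (by omega) (by omega)

lemma memWindow_eq_window (h : ∀ l, m ≤ l → l < i → X l = some (a l)) :
    memWindow X m i = window a m i := by
  rw [memWindow_congr h, memWindow_eq_filterMap, window_eq_map, ← List.filterMap_eq_map]
  rfl

lemma window_add_one (a : ℤ → A) (h : m ≤ i) : window a m (i + 1) = a i :: window a m i := by
  simp only [window_eq_map]
  rw [show (i + 1 - m).toNat = (i - m).toNat + 1 by omega, List.range_succ_eq_map,
    List.map_cons, List.map_map]
  refine congrArg₂ _ (congrArg a (by omega)) (List.map_congr_left fun j _ => congrArg a ?_)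
  push_cast
  omega

end Windows

/-! ### The algorithm -/

section Algorithm

variable {A : Type*} [Encodable A] {P : Stream' A → PMF A} {w : List A} {u : ℤ → ℝ}

lemma Constructible.lt_alphaNegOne {m : ℤ} {n : WithTop ℤ} (h : Constructible P w u m n)
    (hmn : m ≤ n) : ENNReal.ofReal (u m) < alphaNegOne P := by
  obtain ⟨a, ha⟩ := h
  have hm := ha m le_rfl hmn
  rw [window_self] at hm
  exact lt_alphaNegOne_of_update_nil hm

/-- The set of the candidates for `θ[m, n]`. -/
def startTimes (P : Stream' A → PMF A) (w : List A) (u : ℤ → ℝ) (m : ℤ) (n : WithTop ℤ) : Set ℤ :=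
  {k | k ≤ m ∧ Constructible P w u k n}

/-- The invariant of the algorithm: every site of `[i, n]` outside of `B` holds a symbol which the
update function produces from a string of sites of `[i, n]` outside of `B`.  That string need not
go back to `i`, as `i` may have moved back since then. -/
structure Justified (P : Stream' A → PMF A) (w : List A) (u : ℤ → ℝ) (X : ℤ → Option A)
    (B : Finset ℤ) (i n : ℤ) : Prop where
  subset : B ⊆ Finset.Icc i n
  exists_update : ∀ j ∈ Set.Icc i n, j ∉ B → ∃ r ∈ Set.Icc i j, (∀ l ∈ Set.Icc r j, l ∉ B) ∧
    ∃ a, X j = some a ∧ update P w (u j) (memWindow X r j) = some a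

namespace Justified

variable {X : ℤ → Option A} {B : Finset ℤ} {i j n t : ℤ} {a : A}

lemma exists_eq_some (h : Justified P w u X B i n) (hj : j ∈ Set.Icc i n) (hB : j ∉ B) :
    ∃ a, X j = some a ∧ update P w (u j) (memWindow X i j) = some a := by
  obtain ⟨r, hr, -, a, hX, hu⟩ := h.exists_update j hj hB
  refine ⟨a, hX, ?_⟩
  rw [← memWindow_append_memWindow X hr.1 hr.2]
  exact update_append hu _

lemma constructible (h : Justified P w u X ∅ i n) (hin : i ≤ n) : Constructible P w u i n := by
  have hX (j : ℤ) (hj : j ∈ Set.Icc i n) := h.exists_eq_some hj (Finset.notMem_empty j)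
  obtain ⟨e, -⟩ := hX i ⟨le_rfl, hin⟩
  have hgetD : ∀ j ∈ Set.Icc i n, X j = some ((X j).getD e) := fun j hj => by
    obtain ⟨a, ha, -⟩ := hX j hj
    rw [ha, Option.getD_some]
  refine ⟨fun j => (X j).getD e, fun j hij hjn => ?_⟩
  rw [WithTop.coe_le_coe] at hjn
  obtain ⟨a, ha, hu⟩ := hX j ⟨hij, hjn⟩
  rw [← memWindow_eq_window fun l hil hlj => hgetD l ⟨hil, by omega⟩, hu, ← ha]
  exact hgetD j ⟨hij, hjn⟩

lemma not_constructible (h : Justified P w u X B i n) (ht : t ∈ Set.Icc i n)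
    (hB : ∀ l ∈ Set.Ico i t, l ∉ B) (hu : update P w (u t) (memWindow X i t) = none) :
    ¬ Constructible P w u i n := by
  rintro ⟨a, ha⟩
  have hX : ∀ k : ℕ, i + k < t → X (i + k) = some (a (i + k)) := by
    intro k
    induction k using Nat.strong_induction_on with
    | _ k ih =>
      intro hk
      have hmem : i + k ∈ Set.Icc i n := ⟨by omega, hk.le.trans ht.2⟩
      obtain ⟨b, hX, hb⟩ := h.exists_eq_some hmem (hB _ ⟨hmem.1, hk⟩)
      rw [hX, ← hb, memWindow_eq_window (a := a), ha _ hmem.1 (WithTop.coe_le_coe.2 hmem.2)]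
      intro l hil hlk
      obtain ⟨d, rfl⟩ := Int.le.dest hil
      exact ih d (by omega) (by omega)
  rw [memWindow_eq_window (a := a), ha t ht.1 (WithTop.coe_le_coe.2 ht.2)] at hu
  · exact Option.some_ne_none _ hu
  · intro l hil hlt
    obtain ⟨d, rfl⟩ := Int.le.dest hil
    exact hX d hlt

lemma insert_sub_one (h : Justified P w u X B i n) (hin : i ≤ n) :
    Justified P w u X (insert (i - 1) B) (i - 1) n where
  subset := by
    refine Finset.insert_subset (Finset.mem_Icc.2 ⟨le_rfl, by omega⟩) (h.subset.trans ?_)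
    exact Finset.Icc_subset_Icc_left (by omega)
  exists_update j hj hjB := by
    rw [Finset.mem_insert, not_or] at hjB
    obtain ⟨r, hr, hrB, hu⟩ := h.exists_update j ⟨by have := hj.1; omega, hj.2⟩ hjB.2
    refine ⟨r, ⟨by have := hr.1; omega, hr.2⟩, fun l hl => ?_, hu⟩
    rw [Finset.mem_insert, not_or]
    exact ⟨by have := hr.1; have := hl.1; omega, hrB l hl⟩

lemma assign (h : Justified P w u X B i n) (ht : t ∈ B) (hB : ∀ l ∈ Set.Ico i t, l ∉ B)
    (hu : update P w (u t) (memWindow X i t) = some a) :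
    Justified P w u (Function.update X t (some a)) (B.erase t) i n where
  subset := (Finset.erase_subset _ _).trans h.subset
  exists_update j hj hjB := by
    have hX : ∀ r k, (∀ l ∈ Set.Ico r k, l ≠ t) →
        memWindow (Function.update X t (some a)) r k = memWindow X r k := fun r k hne =>
      memWindow_congr fun l hrl hlk => Function.update_of_ne (hne l ⟨hrl, hlk⟩) _ _
    rcases eq_or_ne j t with rfl | hjt
    · refine ⟨i, ⟨le_rfl, hj.1⟩, fun l hl hlB => ?_, a, Function.update_self .., ?_⟩
      · obtain ⟨hne, hlB⟩ := Finset.mem_erase.1 hlB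
        exact hB l ⟨hl.1, lt_of_le_of_ne hl.2 hne⟩ hlB
      · rwa [hX i j fun l hl => hl.2.ne]
    · have hjB' : j ∉ B := fun hjB' => hjB (Finset.mem_erase.2 ⟨hjt, hjB'⟩)
      obtain ⟨r, hr, hrB, b, hb, hub⟩ := h.exists_update j hj hjB'
      refine ⟨r, hr, fun l hl hlB => hrB l hl (Finset.mem_of_mem_erase hlB), b, ?_, ?_⟩
      · rwa [Function.update_of_ne hjt]
      · rwa [hX r j fun l hl hlt => hrB l ⟨hl.1, hl.2.le⟩ (hlt ▸ ht)]

end Justified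

/-- Started from the configuration `s`, the algorithm stops and returns `r`; this is `StopsWith`
for an arbitrary initial configuration. -/
def HaltsWith (P : Stream' A → PMF A) (w : List A) (u : ℤ → ℝ) (m : ℤ) (s : Config A) (r : ℤ) :
    Prop :=
  ∃ N : ℕ, ((step P w u m)^[N] s).pc = .halt ∧ ((step P w u m)^[N] s).theta = r

variable {m n r i t θ : ℤ} {B : Finset ℤ} {X : ℤ → Option A} {a : A}

namespace HaltsWith

lemma of_step {s s' : Config A} (hs : step P w u m s = s') (h : HaltsWith P w u m s' r) :
    HaltsWith P w u m s r := by
  obtain ⟨N, hN⟩ := h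
  exact ⟨N + 1, by rwa [Function.iterate_succ_apply, hs]⟩

lemma setTime : HaltsWith P w u m ⟨.setTime, i, t, θ, B, X⟩ i :=
  of_step rfl ⟨0, rfl, rfl⟩

lemma backMove
    (h : HaltsWith P w u m ⟨.skipTest, i - 1, t, θ, insert (i - 1) B, X⟩ r) :
    HaltsWith P w u m ⟨.backMove, i, t, θ, B, X⟩ r :=
  of_step rfl (of_step rfl h)

lemma skipMove
    (h : HaltsWith P w u m ⟨.skipTest, i - 1, t, θ, insert (i - 1) B, X⟩ r) :
    HaltsWith P w u m ⟨.skipMove, i, t, θ, B, X⟩ r :=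
  of_step rfl (of_step rfl h)

lemma fwdAssign (ha : update P w (u i) (memWindow X m i) = some a)
    (h : HaltsWith P w u m
      ⟨.fwdTest, i + 1, t, θ, B.erase i, Function.update X i (some a)⟩ r) :
    HaltsWith P w u m ⟨.fwdAssign, i, t, θ, B, X⟩ r := by
  rw [← ha] at h
  exact of_step rfl (of_step rfl (of_step rfl h))

lemma seedAssign (ha : update P w (u i) [] = some a)
    (h : HaltsWith P w u m
      ⟨.extTest, i, (B.erase i).min.untopD t, θ, B.erase i, Function.update X i (some a)⟩ r) :
    HaltsWith P w u m ⟨.seedAssign, i, t, θ, B, X⟩ r := by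
  rw [← ha] at h
  exact of_step rfl (of_step rfl (of_step rfl h))

lemma extAssign (ha : update P w (u t) (memWindow X i t) = some a)
    (h : HaltsWith P w u m
      ⟨.extTest, i, (B.erase t).min.untopD t, θ, B.erase t, Function.update X t (some a)⟩ r) :
    HaltsWith P w u m ⟨.extAssign, i, t, θ, B, X⟩ r := by
  rw [← ha] at h
  exact of_step rfl (of_step rfl (of_step rfl h))

end HaltsWith

/-- The algorithm returns `r` whenever it is at the test of the outer loop with a current time `i`
for which the invariant holds and `B` is nonempty only if `[i, n]` is not constructible. -/
def HaltsFromOuterTest (P : Stream' A → PMF A) (w : List A) (u : ℤ → ℝ) (m n r i : ℤ) : Prop :=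
  ∀ t θ B X, Justified P w u X B i n → (B.Nonempty → ¬ Constructible P w u i n) →
    HaltsWith P w u m ⟨.outerTest, i, t, θ, B, X⟩ r

/-- The algorithm returns `r` whenever it tests `u i`, on the way back from a time after `i`, with
the invariant in force. -/
def HaltsFromSkipTest (P : Stream' A → PMF A) (w : List A) (u : ℤ → ℝ) (m n r i : ℤ) : Prop :=
  ∀ t θ B X, Justified P w u X B i n → i ∈ B → HaltsWith P w u m ⟨.skipTest, i, t, θ, B, X⟩ r

lemma haltsFromOuterTest (hmn : m ≤ n) (hr : IsGreatest (startTimes P w u m n) r) (him : i ≤ m)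
    (hri : r ≤ i) (hback : r < i → HaltsFromSkipTest P w u m n r (i - 1)) :
    HaltsFromOuterTest P w u m n r i := by
  intro t θ B X hX hB
  by_cases hne : B.Nonempty
  · have hri : r < i := lt_of_le_of_ne hri fun h => hB hne (h ▸ hr.1.2)
    refine .of_step (if_pos hne) (.backMove ?_)
    exact hback hri _ _ _ _ (hX.insert_sub_one (him.trans hmn)) (Finset.mem_insert_self _ _)
  · have hin : Constructible P w u i n := by
      rw [Finset.not_nonempty_iff_eq_empty.1 hne] at hX
      exact hX.constructible (him.trans hmn)
    obtain rfl : i = r := le_antisymm (hr.2 ⟨him, hin⟩) hri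
    exact .of_step (if_neg hne) .setTime

lemma untopD_min_mem (hB : B.Nonempty) : B.min.untopD t ∈ B ∧ ∀ l ∈ B, B.min.untopD t ≤ l := by
  obtain ⟨b, hb⟩ := Finset.min_of_nonempty hB
  rw [hb]
  exact ⟨Finset.mem_of_min hb, fun l hl => Finset.min_le_of_eq hl hb⟩

lemma haltsWith_extTest (houter : HaltsFromOuterTest P w u m n r i)
    (hX : Justified P w u X B i n) (ht : B.Nonempty → t ∈ B ∧ ∀ l ∈ B, t ≤ l) :
    HaltsWith P w u m ⟨.extTest, i, t, θ, B, X⟩ r := by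
  induction B using Finset.strongInduction generalizing t X with
  | H B ih =>
    by_cases hne : B.Nonempty
    swap
    · exact .of_step (if_neg fun h => hne h.1) (houter _ _ _ _ hX fun h => absurd h hne)
    obtain ⟨htB, hmin⟩ := ht hne
    have hlt : ∀ l ∈ Set.Ico i t, l ∉ B := fun l hl hlB => (hmin l hlB).not_gt hl.2
    cases hu : update P w (u t) (memWindow X i t) with
    | none =>
      refine .of_step (if_neg fun h => by simp [hu] at h) (houter _ _ _ _ hX fun _ => ?_)
      exact hX.not_constructible (Finset.mem_Icc.1 (hX.subset htB)) hlt hu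
    | some a =>
      refine .of_step (if_pos ⟨hne, by simp [hu]⟩) (.extAssign hu ?_)
      exact ih _ (Finset.erase_ssubset htB) (hX.assign htB hlt hu) untopD_min_mem

lemma haltsFromSkipTest_of_sub_one (hmn : m ≤ n) (hr : IsGreatest (startTimes P w u m n) r)
    (him : i ≤ m) (hri : r ≤ i) (hback : r < i → HaltsFromSkipTest P w u m n r (i - 1)) :
    HaltsFromSkipTest P w u m n r i := by
  intro t θ B X hX hiB
  rcases le_or_gt (alphaNegOne P) (ENNReal.ofReal (u i)) with hu | hu
  · have hri : r < i := by
      refine lt_of_le_of_ne hri fun h => hu.not_gt ?_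
      rw [← h]
      exact hr.1.2.lt_alphaNegOne (WithTop.coe_le_coe.2 (hr.1.1.trans hmn))
    refine .of_step (if_pos hu) (.skipMove ?_)
    exact hback hri _ _ _ _ (hX.insert_sub_one (him.trans hmn)) (Finset.mem_insert_self _ _)
  · obtain ⟨a, ha⟩ := exists_update_of_lt_alphaNegOne hu w []
    refine .of_step (if_neg hu.not_ge) (.seedAssign ha ?_)
    refine haltsWith_extTest (haltsFromOuterTest hmn hr him hri hback) (n := n) ?_ untopD_min_mem
    refine hX.assign hiB (fun l hl => absurd hl.2 hl.1.not_gt) ?_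
    rwa [memWindow_self]

lemma haltsFromSkipTest (hmn : m ≤ n) (hr : IsGreatest (startTimes P w u m n) r)
    (hri : r ≤ i) (him : i ≤ m) : HaltsFromSkipTest P w u m n r i := by
  induction i, hri using Int.leInduction with
  | base => exact haltsFromSkipTest_of_sub_one hmn hr him le_rfl fun h => absurd h (lt_irrefl r)
  | succ i hri ih =>
    refine haltsFromSkipTest_of_sub_one hmn hr him (by omega) fun _ => ?_
    rw [add_sub_cancel_right]
    exact ih (by omega)

lemma haltsWith_fwdTest (houter : HaltsFromOuterTest P w u m n r m) (hmi : m ≤ i)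
    (hX : Justified P w u X (Finset.Icc i n) m n) :
    HaltsWith P w u m ⟨.fwdTest, i, t, θ, Finset.Icc i n, X⟩ r := by
  have hlt : ∀ l ∈ Set.Ico m i, l ∉ Finset.Icc i n := fun l hl hl' =>
    (Finset.mem_Icc.1 hl').1.not_gt hl.2
  induction hd : (n + 1 - i).toNat generalizing i X with
  | zero =>
    have hempty : ¬ (Finset.Icc i n).Nonempty := by rw [Finset.nonempty_Icc]; omega
    refine .of_step (if_neg fun h => hempty h.1) (.of_step rfl ?_)
    exact houter _ _ _ _ hX fun h => absurd h hempty
  | succ d ih =>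
    have hin : i ≤ n := by omega
    cases hu : update P w (u i) (memWindow X m i) with
    | none =>
      refine .of_step (if_neg fun h => by simp [hu] at h) (.of_step rfl ?_)
      exact houter _ _ _ _ hX fun _ => hX.not_constructible ⟨hmi, hin⟩ hlt hu
    | some a =>
      have hX' := hX.assign (Finset.left_mem_Icc.2 hin) hlt hu
      refine .of_step (if_pos ⟨Finset.nonempty_Icc.2 hin, by simp [hu]⟩) (.fwdAssign (i := i) hu ?_)
      have herase : (Finset.Icc i n).erase i = Finset.Icc (i + 1) n := by
        rw [Finset.Icc_erase_left]
        exact (Finset.Icc_succ_left_eq_Ioc i n).symm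
      rw [herase] at hX' ⊢
      exact ih (by omega) hX' (fun l hl hl' => (Finset.mem_Icc.1 hl').1.not_gt hl.2) (by omega)

lemma stopsWith_of_isGreatest (hmn : m ≤ n) (hr : IsGreatest (startTimes P w u m n) r) :
    StopsWith P w u m n r := by
  have houter : HaltsFromOuterTest P w u m n r m :=
    haltsFromOuterTest hmn hr le_rfl hr.1.1 fun hrm =>
      haltsFromSkipTest hmn hr (by omega) (by omega)
  refine haltsWith_fwdTest houter le_rfl ⟨subset_rfl, fun j hj hjB => ?_⟩
  exact absurd (Finset.mem_Icc.2 hj) hjB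

end Algorithm

/-! ### The regeneration time -/

section RegenTime

variable {A : Type*} [Encodable A] {P : Stream' A → PMF A} {w : List A} {u : ℤ → ℝ}
  {k m : ℤ} {n : WithTop ℤ}

lemma exists_regenTime_eq (h : (startTimes P w u m n).Nonempty) :
    ∃ r : ℤ, regenTime P w u m n = r ∧ IsGreatest (startTimes P w u m n) r := by
  have hbdd : BddAbove (startTimes P w u m n) := ⟨m, fun k hk => hk.1⟩
  exact ⟨_, if_pos h, Int.csSup_mem h hbdd, fun k hk => le_csSup hbdd hk⟩

lemma le_regenTime (h : k ∈ startTimes P w u m n) : (k : WithBot ℤ) ≤ regenTime P w u m n := by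
  obtain ⟨r, hr, hgreatest⟩ := exists_regenTime_eq ⟨k, h⟩
  rw [hr, WithBot.coe_le_coe]
  exact hgreatest.2 h

end RegenTime

/-! ### A local condition for regeneration -/

section Secured

variable {A : Type*} [Encodable A] {P : Stream' A → PMF A} {w v : List A} {x : ℕ → ℝ}
  {d i j l s : ℕ}

/-- The variables `x j, x (j + 1), …` produce the symbols of `v` whatever the past. -/
def SpellsAt (P : Stream' A → PMF A) (x : ℕ → ℝ) (j : ℕ) : List A → Prop
  | [] => True
  | a :: v => ENNReal.ofReal (x (j + v.length)) ∈ spontInterval P a ∧ SpellsAt P x j v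

lemma SpellsAt.shift (h : SpellsAt P (fun k => x (d + k)) j v) : SpellsAt P x (d + j) v := by
  induction v with
  | nil => trivial
  | cons a v ih => exact ⟨(add_assoc d j v.length) ▸ h.1, ih h.2⟩

lemma SpellsAt.lt_alphaNegOne (h : SpellsAt P x j v) (hji : j ≤ i) (hi : i < j + v.length) :
    ENNReal.ofReal (x i) < alphaNegOne P := by
  induction v with
  | nil => exact absurd hi hji.not_gt
  | cons a v ih =>
    rcases (Nat.lt_succ_iff.1 hi).lt_or_eq with hlt | rfl
    · exact ih h.2 hlt
    · exact lt_alphaNegOne_of_mem_spontInterval h.1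

/-- A condition on `x 0, …, x i` which ensures that the construction started at `0` passes `i`.  The
word spelled at `j` need not be the last occurrence of `w` before `i`: a later occurrence only makes
more of the past available as context. -/
def Secured (P : Stream' A → PMF A) (w : List A) (x : ℕ → ℝ) (i : ℕ) : Prop :=
  ENNReal.ofReal (x i) < alphaNegOne P ∨
    ∃ j, j + w.length ≤ i ∧ SpellsAt P x j w ∧ ENNReal.ofReal (x i) < alpha P w j

lemma Secured.of_shift (h : Secured P w (fun k => x (d + k)) i) : Secured P w x (d + i) := by
  refine h.imp_right fun ⟨j, hji, hj, hx⟩ => ⟨d + j, by omega, hj.shift, hx.trans_le ?_⟩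
  exact alpha_mono P w (Nat.le_add_left j d)

/-- Every site of `[0, ∞)` satisfies the condition `Secured`. -/
def AllSecured (P : Stream' A → PMF A) (w : List A) (x : ℕ → ℝ) : Prop :=
  ∀ i, Secured P w x i

/-- No `s ≤ l` is such that all the sites of `[s, l]` satisfy the condition `Secured` relative to
the starting time `s`. -/
def NoSecuredStart (P : Stream' A → PMF A) (w : List A) (x : ℕ → ℝ) (l : ℕ) : Prop :=
  ∀ s ≤ l, ∃ i, s + i ≤ l ∧ ¬ Secured P w (fun k => x (s + k)) i

lemma exists_allSecured {L : ℕ} (h : ∀ n ≥ L, ¬ NoSecuredStart P w x n) :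
    ∃ s ≤ L, AllSecured P w fun k => x (s + k) := by
  have hstart : ∀ n ≥ L, ∃ s ≤ L, ∀ i, s + i ≤ n → Secured P w (fun k => x (s + k)) i := by
    intro n
    induction n using Nat.strong_induction_on with
    | _ n ih =>
      intro hn
      obtain ⟨t, htn, ht⟩ : ∃ t ≤ n, ∀ i, t + i ≤ n → Secured P w (fun k => x (t + k)) i := by
        simpa only [NoSecuredStart, not_forall, not_exists, not_and, not_not, exists_prop]
          using h n hn
      rcases le_or_gt t L with htL | htL
      · exact ⟨t, htL, ht⟩
      obtain ⟨s, hsL, hs⟩ := ih (t - 1) (by omega) (by omega)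
      refine ⟨s, hsL, fun i hi => ?_⟩
      rcases lt_or_ge (s + i) t with hit | hit
      · exact hs i (by omega)
      · obtain ⟨e, rfl⟩ : ∃ e, i = (t - s) + e := ⟨s + i - t, by omega⟩
        refine Secured.of_shift ?_
        have hte := ht e (by omega)
        simp only [← add_assoc, Nat.add_sub_cancel' (hsL.trans htL.le)]
        exact hte
  by_contra! hfail
  simp only [AllSecured, not_forall] at hfail
  choose! i hi using hfail
  obtain ⟨s, hsL, hs⟩ := hstart (L + (Finset.range (L + 1)).sup fun s => s + i s) (by omega)
  refine hi s hsL (hs _ (le_add_left ?_))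
  exact Finset.le_sup (f := fun s => s + i s) (Finset.mem_range_succ_iff.2 hsL)

/-- The string constructed from `x 0, …, x (k - 1)`, where the symbol `e` stands in for `⋆`. -/
noncomputable def simulate (P : Stream' A → PMF A) (w : List A) (e : A) (x : ℕ → ℝ) : ℕ → List A
  | 0 => []
  | k + 1 => (update P w (x k) (simulate P w e x k)).getD e :: simulate P w e x k

variable {e : A}

lemma length_simulate (k : ℕ) : (simulate P w e x k).length = k := by
  induction k with
  | zero => rfl
  | succ k ih => rw [simulate, List.length_cons, ih]

lemma drop_simulate (k d : ℕ) : (simulate P w e x (k + d)).drop d = simulate P w e x k := by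
  induction d with
  | zero => rfl
  | succ _ ih => exact ih

lemma SpellsAt.prefix_simulate (h : SpellsAt P x j v) :
    v <+: simulate P w e x (j + v.length) := by
  induction v with
  | nil => exact List.nil_prefix
  | cons a v ih =>
    change a :: v <+: simulate P w e x (j + v.length + 1)
    rw [simulate, update_of_mem_spontInterval h.1]
    exact List.cons_prefix_cons.2 ⟨rfl, ih h.2⟩

lemma Secured.exists_update_simulate (h : Secured P w x i) :
    ∃ a, update P w (x i) (simulate P w e x i) = some a := by
  rcases h with h | ⟨j, hji, hj, hx⟩
  · exact exists_update_of_lt_alphaNegOne h w _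
  · obtain ⟨m, rfl⟩ := Nat.exists_eq_add_of_le hji
    refine exists_update_of_hasContext (hasContext_of_prefix_drop (m := m) ?_ ?_) hx
    · rw [drop_simulate]
      exact hj.prefix_simulate
    · rw [length_simulate]
      omega

variable {u : ℤ → ℝ} {n : WithTop ℤ}

lemma constructible_of_secured [Nonempty A] {s : ℤ}
    (h : ∀ i : ℕ, ((s + i : ℤ) : WithTop ℤ) ≤ n → Secured P w (fun k : ℕ => u (s + k)) i) :
    Constructible P w u s n := by
  obtain ⟨e⟩ := ‹Nonempty A›
  let sim : ℕ → List A := simulate P w e fun k : ℕ => u (s + k)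
  let a : ℤ → A := fun i => (update P w (u i) (sim (i - s).toNat)).getD e
  have ha (k : ℕ) : a (s + k) = (update P w (u (s + k)) (sim k)).getD e := by
    simp only [a, add_sub_cancel_left, Int.toNat_natCast]
  have hwindow (k : ℕ) : window a s (s + k) = sim k := by
    induction k with
    | zero =>
      rw [Nat.cast_zero, add_zero]
      exact window_self a s
    | succ k ih =>
      rw [Nat.cast_add_one, ← add_assoc, window_add_one a (by omega), ih, ha]
      rfl
  refine ⟨a, fun i hsi hin => ?_⟩
  obtain ⟨k, rfl⟩ := Int.le.dest hsi
  obtain ⟨b, hb⟩ := (h k hin).exists_update_simulate (e := e)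
  rw [hwindow, ha]
  exact hb.trans (congrArg some (Option.getD_eq_iff.2 (Or.inl hb)).symm)

lemma sub_le_regenTime_of_not_noSecuredStart [Nonempty A] {n : ℤ}
    (h : ¬ NoSecuredStart P w (fun k : ℕ => u (n - l + k)) l) :
    ((n - l : ℤ) : WithBot ℤ) ≤ regenTime P w u n n := by
  simp only [NoSecuredStart, not_forall, not_exists, not_and, not_not, exists_prop] at h
  obtain ⟨s, hsl, hs⟩ := h
  refine le_trans (WithBot.coe_le_coe.2 (le_add_of_nonneg_right (Nat.cast_nonneg s)))
    (le_regenTime (k := n - l + s) ⟨by omega, constructible_of_secured fun i hi => ?_⟩)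
  rw [WithTop.coe_le_coe] at hi
  simpa only [Nat.cast_add, add_assoc] using hs i (by omega)

end Secured

/-! ### Independent uniform variables -/

section IIDUniform

variable {Ω Ω' ι κ : Type*} {mΩ : MeasurableSpace Ω} {mΩ' : MeasurableSpace Ω'} {μ : Measure Ω}
  {ν : Measure Ω'}

/-- The variables `X i` are independent and uniform on `[0, 1)`. -/
structure IsIIDUniform (X : ι → Ω → ℝ) (μ : Measure Ω) : Prop where
  measurable : ∀ i, Measurable (X i)
  isUniform : ∀ i, pdf.IsUniform (X i) (Set.Ico 0 1) μ volume
  iIndepFun : iIndepFun X μ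

/-- The σ-algebra generated by the variables `X i` with `i ∈ S`. -/
abbrev sigmaOn (X : ι → Ω → ℝ) (S : Set ι) : MeasurableSpace Ω :=
  ⨆ i ∈ S, MeasurableSpace.comap (X i) inferInstance

variable {X : ι → Ω → ℝ} {Y : ι → Ω' → ℝ} {S T : Set ι} {i : ι}

lemma measurable_sigmaOn (hi : i ∈ S) : Measurable[sigmaOn X S] (X i) :=
  measurable_iff_comap_le.2 <|
    le_iSup₂_of_le (f := fun i (_ : i ∈ S) => MeasurableSpace.comap (X i) inferInstance) i hi le_rfl

lemma sigmaOn_mono (h : S ⊆ T) : sigmaOn X S ≤ sigmaOn X T :=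
  biSup_mono h

namespace IsIIDUniform

lemma precomp (h : IsIIDUniform X μ) {g : κ → ι} (hg : g.Injective) :
    IsIIDUniform (fun k => X (g k)) μ :=
  ⟨fun k => h.measurable (g k), fun k => h.isUniform (g k), h.iIndepFun.precomp hg⟩

lemma measure_mem_eq [Countable ι] (hX : IsIIDUniform X μ) (hY : IsIIDUniform Y ν)
    {B : Set (ι → ℝ)} (hB : MeasurableSet B) :
    μ {ω | (fun i => X i ω) ∈ B} = ν {ω | (fun i => Y i ω) ∈ B} :=
  (IdentDistrib.pi (fun i => ⟨(hX.measurable i).aemeasurable, (hY.measurable i).aemeasurable,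
    (hX.isUniform i).trans (hY.isUniform i).symm⟩) hX.iIndepFun hY.iIndepFun).measure_mem_eq hB

lemma measure_ofReal_lt (h : IsIIDUniform X μ) (i : ι) {x : ℝ≥0∞} (hx : x ≤ 1) :
    μ {ω | ENNReal.ofReal (X i ω) < x} = x := by
  have hx_top : x ≠ ∞ := ne_top_of_le_ne_top ENNReal.one_ne_top hx
  have hinter : Set.Ico (0 : ℝ) 1 ∩ {v | ENNReal.ofReal v < x} = Set.Ico 0 x.toReal := by
    ext v
    simp only [Set.mem_inter_iff, Set.mem_Ico, Set.mem_ofPred_eq]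
    have hx1 : x.toReal ≤ 1 := ENNReal.toReal_le_of_le_ofReal zero_le_one (by simpa using hx)
    exact ⟨fun ⟨⟨h0, _⟩, h1⟩ => ⟨h0, (ENNReal.ofReal_lt_iff_lt_toReal h0 hx_top).1 h1⟩,
      fun ⟨h0, h1⟩ => ⟨⟨h0, h1.trans_le hx1⟩, (ENNReal.ofReal_lt_iff_lt_toReal h0 hx_top).2 h1⟩⟩
  refine (pdf.IsUniform.measure_preimage (by simp) (by simp) (h.isUniform i)
    (measurableSet_lt ENNReal.measurable_ofReal measurable_const)).trans ?_
  rw [hinter, Real.volume_Ico, Real.volume_Ico, sub_zero, sub_zero, ENNReal.ofReal_one, div_one,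
    ENNReal.ofReal_toReal hx_top]

lemma measurableSet_ofReal_lt (h : IsIIDUniform X μ) (i : ι) (x : ℝ≥0∞) :
    MeasurableSet {ω | ENNReal.ofReal (X i ω) < x} :=
  (h.measurable i).ennreal_ofReal measurableSet_Iio

lemma measure_ofReal_mem_Ico (h : IsIIDUniform X μ) (i : ι) {x y : ℝ≥0∞} (hxy : x ≤ y)
    (hy : y ≤ 1) : μ {ω | ENNReal.ofReal (X i ω) ∈ Set.Ico x y} = y - x := by
  have hsdiff : {ω | ENNReal.ofReal (X i ω) ∈ Set.Ico x y} =
      {ω | ENNReal.ofReal (X i ω) < y} \ {ω | ENNReal.ofReal (X i ω) < x} := by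
    ext ω
    simp only [Set.mem_Ico, Set.mem_sdiff, Set.mem_ofPred_eq, not_lt, and_comm]
  have hx := h.measure_ofReal_lt i (hxy.trans hy)
  have hsub : {ω | ENNReal.ofReal (X i ω) < x} ⊆ {ω | ENNReal.ofReal (X i ω) < y} :=
    fun ω hω => lt_of_lt_of_le hω hxy
  rw [hsdiff, measure_sdiff hsub (h.measurableSet_ofReal_lt i x).nullMeasurableSet, hx,
    h.measure_ofReal_lt i hy]
  exact hx.trans_ne (ne_top_of_le_ne_top ENNReal.one_ne_top (hxy.trans hy))

lemma measure_le_ofReal (h : IsIIDUniform X μ) (i : ι) {x : ℝ≥0∞} (hx : x ≤ 1) :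
    μ {ω | x ≤ ENNReal.ofReal (X i ω)} = 1 - x := by
  have := h.iIndepFun.isProbabilityMeasure
  have hcompl := prob_compl_eq_one_sub (μ := μ) (h.measurableSet_ofReal_lt i x)
  rw [h.measure_ofReal_lt i hx] at hcompl
  simpa only [Set.compl_ofPred, not_lt] using hcompl

lemma measure_mem_spontInterval (h : IsIIDUniform X μ) {A : Type*} [Encodable A]
    (P : Stream' A → PMF A) (i : ι) (a : A) :
    μ {ω | ENNReal.ofReal (X i ω) ∈ spontInterval P a} = spontMass P a := by
  have : Nonempty A := ⟨a⟩
  have hle : cumLength (spontMass P) (Encodable.encode a + 1) ≤ 1 :=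
    ((le_iSup _ _).trans_eq (iSup_cumLength (spontMass P))).trans
      ((alphaNegOne_le_alpha P [] 0).trans (alpha_le_one P [] 0))
  rw [cumLength_encode_succ] at hle
  refine (h.measure_ofReal_mem_Ico i le_self_add ?_).trans (ENNReal.add_sub_cancel_left ?_)
  · rwa [zero_add]
  · rw [zero_add]
    exact ne_top_of_le_ne_top ENNReal.one_ne_top (le_self_add.trans hle)

lemma sigmaOn_le (h : IsIIDUniform X μ) (S : Set ι) : sigmaOn X S ≤ mΩ :=
  iSup₂_le fun i _ => (h.measurable i).comap_le

lemma measure_inter_of_disjoint (h : IsIIDUniform X μ) (hST : Disjoint S T) {E F : Set Ω}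
    (hE : MeasurableSet[sigmaOn X S] E) (hF : MeasurableSet[sigmaOn X T] F) :
    μ (E ∩ F) = μ E * μ F :=
  (Indep_iff _ _ μ).1 (indep_iSup_of_disjoint (fun i => (h.measurable i).comap_le) h.iIndepFun hST)
    E F hE hF

lemma measure_biInter_of_pairwiseDisjoint (h : IsIIDUniform X μ) {S : κ → Set ι}
    (hS : Pairwise (Function.onFun Disjoint S)) {E : κ → Set Ω}
    (hE : ∀ k, MeasurableSet[sigmaOn X (S k)] (E k)) (s : Finset κ) :
    μ (⋂ k ∈ s, E k) = ∏ k ∈ s, μ (E k) := by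
  classical
  induction s using Finset.induction_on with
  | empty =>
    have := h.iIndepFun.isProbabilityMeasure
    simp
  | insert k s hk ih =>
    rw [Finset.set_biInter_insert, Finset.prod_insert hk, ← ih]
    refine h.measure_inter_of_disjoint (T := ⋃ l ∈ s, S l) ?_ (hE k) ?_
    · exact Set.disjoint_iUnion₂_right.2 fun l hl => hS (ne_of_mem_of_not_mem hl hk).symm
    · exact Finset.measurableSet_biInter s fun l hl =>
        sigmaOn_mono (Set.subset_biUnion_of_mem hl) _ (hE l)

end IsIIDUniform

end IIDUniform

section Measurability

variable {A : Type*} [Encodable A] {P : Stream' A → PMF A} {w v : List A} {Ω : Type*}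
  {mΩ : MeasurableSpace Ω} {X : ℕ → Ω → ℝ}

lemma measurableSet_spellsAt {j : ℕ} (hX : ∀ i, j ≤ i → i < j + v.length → Measurable (X i)) :
    MeasurableSet {ω | SpellsAt P (fun i => X i ω) j v} := by
  induction v with
  | nil => exact MeasurableSet.univ
  | cons a v ih =>
    refine MeasurableSet.inter ?_ (ih fun i hji hi => hX i hji (Nat.lt_succ_of_lt hi))
    exact (hX _ (Nat.le_add_right _ _) (Nat.lt_succ_self _)).ennreal_ofReal measurableSet_Ico

lemma measurableSet_secured {i : ℕ} (hX : ∀ k ≤ i, Measurable (X k)) :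
    MeasurableSet {ω | Secured P w (fun k => X k ω) i} := by
  have hlt (x : ℝ≥0∞) : MeasurableSet {ω | ENNReal.ofReal (X i ω) < x} :=
    (hX i le_rfl).ennreal_ofReal measurableSet_Iio
  have heq : {ω | Secured P w (fun k => X k ω) i} =
      {ω | ENNReal.ofReal (X i ω) < alphaNegOne P} ∪ ⋃ j ∈ {j | j + w.length ≤ i},
        {ω | SpellsAt P (fun k => X k ω) j w} ∩ {ω | ENNReal.ofReal (X i ω) < alpha P w j} := by
    ext ω
    simp only [Secured, Set.mem_union, Set.mem_iUnion, Set.mem_inter_iff, Set.mem_ofPred_eq,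
      exists_prop]
  rw [heq]
  exact (hlt _).union (MeasurableSet.biUnion (Set.to_countable _) fun j hj =>
    (measurableSet_spellsAt fun k _ hk => hX k (hk.le.trans hj)).inter (hlt _))

lemma measurableSet_allSecured (hX : ∀ k, Measurable (X k)) :
    MeasurableSet {ω | AllSecured P w fun k => X k ω} := by
  simp only [AllSecured, Set.ofPred_forall]
  exact MeasurableSet.iInter fun i => measurableSet_secured fun k _ => hX k

lemma measurableSet_noSecuredStart {l : ℕ} (hX : ∀ k ≤ l, Measurable (X k)) :
    MeasurableSet {ω | NoSecuredStart P w (fun k => X k ω) l} := by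
  simp only [NoSecuredStart, Set.ofPred_forall, Set.ofPred_exists, Set.ofPred_and]
  refine MeasurableSet.iInter fun s => MeasurableSet.iInter fun _ =>
    MeasurableSet.iUnion fun i => ?_
  by_cases hi : s + i ≤ l
  · refine (MeasurableSet.const _).inter (measurableSet_secured (X := fun k => X (s + k))
      fun k hk => hX _ (by omega)).compl
  · simp [hi]

end Measurability

/-! ### Positive probability of construction -/

section Positive

variable {A : Type*} [Encodable A] {P : Stream' A → PMF A} {w v : List A} {e : A} {N : ℕ}

/-- From the block `N` on, where the block `j` is `[j * v.length, (j + 1) * v.length)`: the variable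
at the site `k` is below the level with `k / (2 * v.length)` symbols of context, and for every `K`
one of the blocks `K, …, 2 * K - 1` spells `v`. -/
def TailGood (P : Stream' A → PMF A) (w v : List A) (N : ℕ) (x : ℕ → ℝ) : Prop :=
  (∀ k ≥ N * v.length, ENNReal.ofReal (x k) < alpha P w (k / (2 * v.length))) ∧
    ∀ K ≥ N, ∃ j ∈ Finset.Ico K (2 * K), SpellsAt P x (j * v.length) v

lemma TailGood.allSecured {x : ℕ → ℝ} (hx : TailGood P w (e :: w) N x) (hN : N ≠ 0)
    (hinit : ∀ j < N, SpellsAt P x (j * (e :: w).length) (e :: w)) : AllSecured P w x := by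
  intro k
  obtain ⟨hlevel, hblock⟩ := hx
  have hQ : (e :: w).length = w.length + 1 := rfl
  generalize (e :: w).length = Q at hinit hlevel hblock hQ
  have hQ_pos : 0 < Q := by omega
  have of_block {j : ℕ} (hk : N * Q ≤ k) (hj : SpellsAt P x (j * Q) (e :: w))
      (hjk : (j + 1) * Q ≤ k) (hkj : k / (2 * Q) ≤ j) : Secured P w x k := by
    refine Or.inr ⟨j * Q, ?_, hj.2, (hlevel k hk).trans_le (alpha_mono P w ?_)⟩
    · rw [add_one_mul] at hjk
      omega
    · exact hkj.trans (Nat.le_mul_of_pos_right j hQ_pos)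
  rcases lt_or_ge k (N * Q) with hk | hk
  · refine Or.inl ((hinit (k / Q) ((Nat.div_lt_iff_lt_mul hQ_pos).2 hk)).lt_alphaNegOne
      (Nat.div_mul_le_self k Q) ?_)
    exact (Nat.lt_div_mul_add hQ_pos).trans_eq (by rw [hQ, List.length_cons])
  · rcases lt_or_ge (k / (2 * Q)) N with hK | hK
    · refine of_block hk (hinit (N - 1) (by omega)) ?_ (by omega)
      rwa [Nat.sub_add_cancel (by omega)]
    · obtain ⟨j, hj, hspell⟩ := hblock _ hK
      rw [Finset.mem_Ico] at hj
      refine of_block hk hspell ?_ hj.1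
      calc (j + 1) * Q ≤ 2 * (k / (2 * Q)) * Q := Nat.mul_le_mul_right Q hj.2
        _ = k / (2 * Q) * (2 * Q) := by ring
        _ ≤ k := Nat.div_mul_le_self k (2 * Q)

variable {Ω : Type*} {mΩ : MeasurableSpace Ω} {μ : Measure Ω} {X : ℕ → Ω → ℝ}

lemma measure_spellsAt (h : IsIIDUniform X μ) (v : List A) (j : ℕ) :
    μ {ω | SpellsAt P (fun i => X i ω) j v} = (v.map (spontMass P)).prod := by
  induction v with
  | nil =>
    have := h.iIndepFun.isProbabilityMeasure
    exact measure_univ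
  | cons a v ih =>
    rw [List.map_cons, List.prod_cons, ← ih, ← h.measure_mem_spontInterval P (j + v.length) a]
    refine h.measure_inter_of_disjoint (S := {j + v.length}) (T := Set.Iio (j + v.length)) ?_ ?_ ?_
    · exact Set.disjoint_singleton_left.2 (Set.notMem_Iio.2 le_rfl)
    · exact (measurable_sigmaOn (Set.mem_singleton _)).ennreal_ofReal measurableSet_Ico
    · exact @measurableSet_spellsAt _ _ _ _ _ (sigmaOn X _) _ _ fun i _ hi => measurable_sigmaOn hi

lemma measurableSet_sigmaOn_spellsAt {S : Set ℕ} {j : ℕ} (hS : Set.Ico j (j + v.length) ⊆ S) :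
    MeasurableSet[sigmaOn X S] {ω | SpellsAt P (fun i => X i ω) j v} :=
  @measurableSet_spellsAt _ _ _ _ _ (sigmaOn X S) _ _
    fun _ hji hi => measurable_sigmaOn (hS ⟨hji, hi⟩)

lemma measure_biInter_blocks (h : IsIIDUniform X μ) {Q : ℕ} {E : ℕ → Set Ω} {p : ℝ≥0∞}
    (hE : ∀ j, MeasurableSet[sigmaOn X (Set.Ico (j * Q) (j * Q + Q))] (E j))
    (hp : ∀ j, μ (E j) = p) (s : Finset ℕ) : μ (⋂ j ∈ s, E j) = p ^ s.card := by
  have hdisj : Pairwise (Function.onFun Disjoint fun j : ℕ => Set.Ico (j * Q) (j * Q + Q)) := by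
    have hmono : Monotone fun j : ℕ => j * Q := fun _ _ hij => Nat.mul_le_mul_right Q hij
    simpa only [Order.succ_eq_add_one, add_one_mul] using hmono.pairwise_disjoint_on_Ico_succ
  rw [h.measure_biInter_of_pairwiseDisjoint hdisj hE, Finset.prod_congr rfl fun j _ => hp j,
    Finset.prod_const]

lemma measure_forall_spellsAt (h : IsIIDUniform X μ) (v : List A) (N : ℕ) :
    μ {ω | ∀ j < N, SpellsAt P (fun i => X i ω) (j * v.length) v} =
      (v.map (spontMass P)).prod ^ N := by
  have hblocks := measure_biInter_blocks h
    (fun j => measurableSet_sigmaOn_spellsAt (P := P) (j := j * v.length) subset_rfl)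
    (fun j => measure_spellsAt h v _) (Finset.range N)
  simpa only [Finset.mem_range, Finset.card_range, ← Set.ofPred_forall] using hblocks

lemma measure_forall_not_spellsAt (h : IsIIDUniform X μ) (v : List A) (K : ℕ) :
    μ {ω | ∀ j ∈ Finset.Ico K (2 * K), ¬ SpellsAt P (fun i => X i ω) (j * v.length) v} =
      (1 - (v.map (spontMass P)).prod) ^ K := by
  have := h.iIndepFun.isProbabilityMeasure
  have hmeas (j : ℕ) := measurableSet_sigmaOn_spellsAt (X := X) (P := P) (j := j * v.length)
    (Set.Subset.refl (Set.Ico (j * v.length) (j * v.length + v.length)))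
  have hblocks := measure_biInter_blocks h (fun j => (hmeas j).compl)
    (fun j => by rw [prob_compl_eq_one_sub (h.sigmaOn_le _ _ (hmeas j)), measure_spellsAt h])
    (Finset.Ico K (2 * K))
  rw [Nat.card_Ico, two_mul, Nat.add_sub_cancel] at hblocks
  simpa only [two_mul, Set.compl_ofPred, ← Set.ofPred_forall] using hblocks

lemma tendsto_measure_iUnion_add {E : ℕ → Set Ω} (hE : ∑' k, μ (E k) ≠ ∞) :
    Filter.Tendsto (fun n => μ (⋃ k, E (k + n))) Filter.atTop (nhds 0) :=
  tendsto_of_tendsto_of_tendsto_of_le_of_le tendsto_const_nhds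
    (ENNReal.tendsto_sum_nat_add _ hE) (fun _ => zero_le) fun _ => measure_iUnion_le _

lemma tendsto_measure_not_tailGood (h : IsIIDUniform X μ) (hv : v ≠ [])
    (hv_pos : (v.map (spontMass P)).prod ≠ 0) (hα : ∑' k, (1 - alpha P w k) < ∞) :
    Filter.Tendsto (fun N => μ {ω | ¬ TailGood P w v N fun k => X k ω}) Filter.atTop (nhds 0) := by
  let level (k : ℕ) : Set Ω := {ω | alpha P w (k / (2 * v.length)) ≤ ENNReal.ofReal (X k ω)}
  let gap (K : ℕ) : Set Ω :=
    {ω | ∀ j ∈ Finset.Ico K (2 * K), ¬ SpellsAt P (fun i => X i ω) (j * v.length) v}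
  have : Nonempty A := ⟨v.head hv⟩
  have hQ : 0 < v.length := List.length_pos_iff.2 hv
  have hlevel : ∑' k, μ (level k) ≠ ∞ := by
    have : NeZero (2 * v.length) := ⟨by omega⟩
    simp only [level, h.measure_le_ofReal _ (alpha_le_one P w _)]
    rw [tsum_div_eq_mul_tsum (fun k => 1 - alpha P w k)]
    exact ENNReal.mul_ne_top (ENNReal.natCast_ne_top _) hα.ne
  have hgap : ∑' K, μ (gap K) ≠ ∞ := by
    simp only [gap, measure_forall_not_spellsAt h, ENNReal.tsum_geometric]
    exact ENNReal.inv_ne_top.2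
      (tsub_pos_of_lt (ENNReal.sub_lt_self ENNReal.one_ne_top one_ne_zero hv_pos)).ne'
  have hlim := ((tendsto_measure_iUnion_add hlevel).comp
    (Filter.tendsto_id.atTop_mul_const' hQ)).add (tendsto_measure_iUnion_add hgap)
  rw [add_zero] at hlim
  refine tendsto_of_tendsto_of_tendsto_of_le_of_le tendsto_const_nhds hlim (fun _ => zero_le)
    fun N => (measure_mono fun ω hω => ?_).trans (measure_union_le _ _)
  by_contra hgood
  simp only [level, gap, Set.mem_union, Set.mem_iUnion, not_or, not_exists, Set.mem_ofPred_eq,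
    not_forall, not_not, not_le, exists_prop, id_eq] at hgood
  refine hω ⟨fun k hk => ?_, fun K hK => ?_⟩
  · simpa only [Nat.sub_add_cancel hk] using hgood.1 (k - N * v.length)
  · simpa only [Nat.sub_add_cancel hK] using hgood.2 (K - N)

lemma measurableSet_tailGood :
    MeasurableSet[sigmaOn X (Set.Ici (N * v.length))]
      {ω | TailGood P w v N fun k => X k ω} := by
  simp only [TailGood, Set.ofPred_and, Set.ofPred_forall]
  refine MeasurableSet.inter (MeasurableSet.iInter fun k => MeasurableSet.iInter fun hk => ?_)
    (MeasurableSet.iInter fun K => MeasurableSet.iInter fun hK => ?_)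
  · exact (measurable_sigmaOn (X := X) (Set.mem_Ici.2 hk)).ennreal_ofReal measurableSet_Iio
  · simp only [Set.ofPred_exists, Set.ofPred_and]
    refine MeasurableSet.iUnion fun j => ?_
    by_cases hj : j ∈ Finset.Ico K (2 * K)
    · refine (MeasurableSet.const _).inter (measurableSet_sigmaOn_spellsAt fun i hi => ?_)
      exact (Nat.mul_le_mul_right _ (hK.trans (Finset.mem_Ico.1 hj).1)).trans hi.1
    · simp only [hj, Set.ofPred_false, Set.empty_inter, MeasurableSet.empty]

lemma measure_allSecured_pos (h : IsIIDUniform X μ) (hE : (minorized P).Nonempty)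
    (hw : ∀ a ∈ w, a ∈ minorized P) (hα : ∑' k, (1 - alpha P w k) < ∞) :
    0 < μ {ω | AllSecured P w fun k => X k ω} := by
  obtain ⟨e, he⟩ := hE
  have := h.iIndepFun.isProbabilityMeasure
  have hp : ((e :: w).map (spontMass P)).prod ≠ 0 := by
    refine List.prod_ne_zero fun h0 => ?_
    obtain ⟨a, ha, ha0⟩ := List.mem_map.1 h0
    exact (List.forall_mem_cons.2 ⟨he, hw⟩ a ha).ne' ha0
  have hlim := tendsto_measure_not_tailGood h (List.cons_ne_nil e w) hp hα
  obtain ⟨N, hN_lt, hN⟩ :=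
    ((hlim.eventually (gt_mem_nhds one_pos)).and (Filter.eventually_ne_atTop 0)).exists
  have hgood : 0 < μ {ω | TailGood P w (e :: w) N fun k => X k ω} := by
    by_contra! h0
    refine hN_lt.ne ((prob_compl_eq_one_iff (h.sigmaOn_le _ _ measurableSet_tailGood)).2 ?_)
    exact le_antisymm h0 zero_le
  have hindep := h.measure_inter_of_disjoint
    (Set.Iio_disjoint_Ici (le_refl (N * (e :: w).length)))
    (E := {ω | ∀ j < N, SpellsAt P (fun i => X i ω) (j * (e :: w).length) (e :: w)}) ?_
    (measurableSet_tailGood (P := P) (w := w) (v := e :: w))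
  · rw [measure_forall_spellsAt h] at hindep
    refine (ENNReal.mul_pos (pow_ne_zero N hp) hgood.ne').trans_le (hindep.symm.trans_le ?_)
    exact measure_mono fun ω hω => hω.2.allSecured hN hω.1
  · simp only [Set.ofPred_forall]
    refine MeasurableSet.iInter fun j => MeasurableSet.iInter fun hj =>
      measurableSet_sigmaOn_spellsAt fun i hi => ?_
    exact hi.2.trans_le ((add_one_mul j _).symm.trans_le (Nat.mul_le_mul_right _ hj))

end Positive

/-! ### The tail of the regeneration time -/

section Tail

variable {A : Type*} [Encodable A] {P : Stream' A → PMF A} {w : List A} {Ω Ω' : Type*}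
  {mΩ : MeasurableSpace Ω} {mΩ' : MeasurableSpace Ω'} {μ : Measure Ω} {ν : Measure Ω'}
  {X : ℕ → Ω → ℝ} {Y : ℕ → Ω' → ℝ} {U : ℤ → Ω → ℝ}

lemma measure_noSecuredStart_eq (hX : IsIIDUniform X μ) (hY : IsIIDUniform Y ν) (l : ℕ) :
    μ {ω | NoSecuredStart P w (fun k => X k ω) l} =
      ν {ω | NoSecuredStart P w (fun k => Y k ω) l} :=
  hX.measure_mem_eq hY (B := {x | NoSecuredStart P w x l}) <|
    measurableSet_noSecuredStart (X := fun k (x : ℕ → ℝ) => x k) fun k _ => measurable_pi_apply k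

lemma measure_allSecured_eq (hX : IsIIDUniform X μ) (hY : IsIIDUniform Y ν) :
    μ {ω | AllSecured P w fun k => X k ω} = ν {ω | AllSecured P w fun k => Y k ω} :=
  hX.measure_mem_eq hY (B := {x | AllSecured P w x}) <|
    measurableSet_allSecured (X := fun k (x : ℕ → ℝ) => x k) measurable_pi_apply

-- The events "no secured start in `[0, l]`, but `[l + 1, ∞)` is secured" are disjoint, and each of
-- them is the intersection of two independent events.
lemma tsum_measure_noSecuredStart_mul_le_one (h : IsIIDUniform X μ) :
    (∑' l, μ {ω | NoSecuredStart P w (fun k => X k ω) l}) *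
      μ {ω | AllSecured P w fun k => X k ω} ≤ 1 := by
  have := h.iIndepFun.isProbabilityMeasure
  let E (l : ℕ) : Set Ω := {ω | NoSecuredStart P w (fun k => X k ω) l} ∩
    {ω | AllSecured P w fun k => X (l + 1 + k) ω}
  have hμE (l : ℕ) : μ (E l) = μ {ω | NoSecuredStart P w (fun k => X k ω) l} *
      μ {ω | AllSecured P w fun k => X k ω} := by
    rw [measure_allSecured_eq h (h.precomp (add_right_injective (l + 1)))]
    refine h.measure_inter_of_disjoint (Set.Iio_disjoint_Ici (le_refl (l + 1))) ?_ ?_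
    · exact @measurableSet_noSecuredStart _ _ _ _ _ (sigmaOn X _) _ _
        fun k hk => measurable_sigmaOn (Nat.lt_succ_of_le hk)
    · exact @measurableSet_allSecured _ _ _ _ _ (sigmaOn X _) (fun k => X (l + 1 + k))
        fun k => measurable_sigmaOn (Nat.le_add_right (l + 1) k)
  have hE_disj : Pairwise (Function.onFun Disjoint E) := by
    refine (pairwise_disjoint_on E).2 fun l l' hl => Set.disjoint_left.2 fun ω hωl hωl' => ?_
    obtain ⟨i, _, hi⟩ := hωl'.1 (l + 1) hl
    exact hi (hωl.2 i)
  have hE_meas (l : ℕ) : MeasurableSet (E l) :=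
    (measurableSet_noSecuredStart fun k _ => h.measurable k).inter
      (measurableSet_allSecured fun k => h.measurable (l + 1 + k))
  simp only [← ENNReal.tsum_mul_right, ← hμE]
  rw [← measure_iUnion hE_disj hE_meas]
  exact prob_le_one

lemma tsum_measure_noSecuredStart_lt_top (h : IsIIDUniform X μ) (hE : (minorized P).Nonempty)
    (hw : ∀ a ∈ w, a ∈ minorized P) (hα : ∑' k, (1 - alpha P w k) < ∞) :
    ∑' l, μ {ω | NoSecuredStart P w (fun k => X k ω) l} < ∞ := by
  refine ENNReal.lt_top_of_mul_ne_top_left ?_ (measure_allSecured_pos h hE hw hα).ne'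
  exact ne_top_of_le_ne_top ENNReal.one_ne_top (tsum_measure_noSecuredStart_mul_le_one h)

lemma IsIIDUniform.shift (h : IsIIDUniform U μ) (s : ℤ) :
    IsIIDUniform (fun k : ℕ => U (s + k)) μ :=
  h.precomp ((add_right_injective s).comp Nat.cast_injective)

lemma tsum_measure_regenTime_lt_top (h : IsIIDUniform U μ) (hE : (minorized P).Nonempty)
    (hw : ∀ a ∈ w, a ∈ minorized P) (hα : ∑' k, (1 - alpha P w k) < ∞) (n : ℤ) :
    ∑' l : ℕ, μ {ω | regenTime P w (fun i => U i ω) n n < ((n - l : ℤ) : WithBot ℤ)} < ∞ := by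
  have : Nonempty A := ⟨hE.some⟩
  refine (ENNReal.tsum_le_tsum fun l => ?_).trans_lt
    (tsum_measure_noSecuredStart_lt_top (h.shift 0) hE hw hα)
  rw [measure_noSecuredStart_eq (h.shift 0) (h.shift (n - l))]
  refine measure_mono fun ω hω => ?_
  by_contra hstart
  exact (sub_le_regenTime_of_not_noSecuredStart (u := fun i => U i ω) hstart).not_gt hω

lemma ae_exists_allSecured (h : IsIIDUniform U μ) (hE : (minorized P).Nonempty)
    (hw : ∀ a ∈ w, a ∈ minorized P) (hα : ∑' k, (1 - alpha P w k) < ∞) (m : ℤ) :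
    ∀ᵐ ω ∂μ, ∃ s ≤ m, AllSecured P w fun k : ℕ => U (s + k) ω := by
  have htail := ENNReal.tendsto_sum_nat_add _
    (tsum_measure_noSecuredStart_lt_top (h.shift 0) hE hw hα).ne
  refine le_antisymm (ge_of_tendsto' htail fun L => ?_) zero_le
  simp only [fun l => measure_noSecuredStart_eq (P := P) (w := w) (h.shift 0) (h.shift (m - L)) l]
  refine (measure_mono fun ω hω => ?_).trans (measure_iUnion_le _)
  by_contra hstart
  simp only [Set.mem_iUnion, not_exists] at hstart
  obtain ⟨s, hs, hsecured⟩ := exists_allSecured (P := P) (w := w) (L := L) fun n hn hno =>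
    hstart (n - L) (by rwa [Set.mem_ofPred_eq, Nat.sub_add_cancel hn])
  refine hω ⟨m - L + s, by omega, ?_⟩
  simpa only [Nat.cast_add, add_assoc] using hsecured

lemma ae_startTimes_nonempty (h : IsIIDUniform U μ) (hE : (minorized P).Nonempty)
    (hw : ∀ a ∈ w, a ∈ minorized P) (hα : ∑' k, (1 - alpha P w k) < ∞) (m : ℤ)
    (n : WithTop ℤ) : ∀ᵐ ω ∂μ, (startTimes P w (fun i => U i ω) m n).Nonempty := by
  have : Nonempty A := ⟨hE.some⟩
  filter_upwards [ae_exists_allSecured h hE hw hα m] with ω ⟨s, hs, hsecured⟩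
  exact ⟨s, hs, constructible_of_secured fun i _ => hsecured i⟩

end Tail

end CFTP

theorem theorem2 {A : Type*} [Encodable A] {Ω : Type*} [MeasurableSpace Ω]
    (μ : Measure Ω) [IsProbabilityMeasure μ]
    (U : ℤ → Ω → ℝ) (hU_meas : ∀ i, Measurable (U i))
    (hU_unif : ∀ i, pdf.IsUniform (U i) (Set.Ico 0 1) μ volume)
    (hU_indep : iIndepFun U μ)
    (P : Stream' A → PMF A) (hE : (CFTP.minorized P).Nonempty)
    (w : List A) (hw : ∀ a ∈ w, a ∈ CFTP.minorized P) :
    -- the two forms of the hypothesis on `α^w_k` are equivalent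
    (∑' k : ℕ, (1 - CFTP.alpha P w k) < ∞ ↔
      0 < ⨅ N : ℕ, ∏ k ∈ Finset.range N, CFTP.alpha P w k) ∧
    (∑' k : ℕ, (1 - CFTP.alpha P w k) < ∞ →
      -- finite windows: the algorithm stops, and it returns the regeneration time
      (∀ m n : ℤ, m ≤ n → ∀ᵐ ω ∂μ, ∃ r : ℤ,
        CFTP.StopsWith P w (fun i => U i ω) m n r ∧
          CFTP.regenTime P w (fun i => U i ω) m n = r) ∧
      -- infinite windows: the regeneration time is finite
      (∀ m : ℤ, ∀ᵐ ω ∂μ, CFTP.regenTime P w (fun i => U i ω) m ⊤ ≠ ⊥) ∧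
      -- summability of the tail of the regeneration time
      (∀ n : ℤ, ∑' l : ℕ,
        μ {ω | CFTP.regenTime P w (fun i => U i ω) n n < ((n - l : ℤ) : WithBot ℤ)} < ∞)) := by
  have : Nonempty A := ⟨hE.some⟩
  have hU : CFTP.IsIIDUniform U μ := ⟨hU_meas, hU_unif, hU_indep⟩
  refine ⟨CFTP.tsum_one_sub_lt_top_iff (CFTP.alpha_le_one P w) fun k =>
    (CFTP.alphaNegOne_pos P hE).trans_le (CFTP.alphaNegOne_le_alpha P w k), fun hα => ?_⟩
  have hstart := CFTP.ae_startTimes_nonempty hU hE hw hα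
  refine ⟨fun m n hmn => ?_, fun m => ?_, CFTP.tsum_measure_regenTime_lt_top hU hE hw hα⟩
  · filter_upwards [hstart m n] with ω hω
    obtain ⟨r, hr, hgreatest⟩ := CFTP.exists_regenTime_eq hω
    exact ⟨r, CFTP.stopsWith_of_isGreatest hmn hgreatest, hr⟩
  · filter_upwards [hstart m ⊤] with ω hω
    obtain ⟨r, hr, -⟩ := CFTP.exists_regenTime_eq hω
    exact hr ▸ WithBot.coe_ne_bot
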